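/- Let $k$ be an algebraically closed field. A \emph{curve} is an integral separated $k$-scheme of finite type of dimension $1$; it is an \emph{irreducible nodal curve} if the local ring at each closed point is either regular or has completion isomorphic to $k[[x,y]]/(xy)$. The \emph{normalization} of an integral scheme $X$ is the morphism $\nu\colon X^\nu\to X$ which over every non-empty affine open $U$ is the spectrum of the integral closure of $\mathcal O_X(U)$ in the function field of $X$. A \emph{symmetric square} of a $k$-scheme $C$ is a $k$-scheme $C^{(2)}$ with an affine $k$-morphism $\pi\colon C\times_k C\to C^{(2)}$ that is the quotient by the involution $\sigma$ exchanging the factors: $\pi\sigma=\pi$, $\pi$ is a topological quotient map whose fibres are the orbits of $\sigma$, and $\mathcal O_{C^{(2)}}=(\pi_*\mathcal O_{C\times C})^{\sigma}$. (1) Let $C_1,\dots,C_n$ ($n\ge 0$) be irreducible nodal curves over $k$ with normalizations $\nu_i\colon C_i^\nu\to C_i$. Then $C_1\times_k\cdots\times_k C_n$ is integral, and $$\nu_1\times\cdots\times\nu_n\colon C_1^\nu\times_k\cdots\times_k C_n^\nu\to C_1\times_k\cdots\times_k C_n$$ is its normalization. (2) Let $C$ be an irreducible nodal curve over $k$ with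 normalization $\nu\colon C^\nu\to C$. If $C$ is projective, then $C$ has a symmetric square. Whenever $C$ (projective or not) has a symmetric square $\pi\colon C\times_k C\to C^{(2)}$, the curve $C^\nu$ also has one; and for every symmetric square $\rho\colon C^\nu\times_k C^\nu\to (C^\nu)^{(2)}$ there is a $k$-morphism $\varphi\colon (C^\nu)^{(2)}\to C^{(2)}$ with $\varphi\circ\rho=\pi\circ(\nu\times\nu)$, the scheme $C^{(2)}$ is integral, and $\varphi$ is its normalization. -/

import Mathlib

open CategoryTheory Limits MonoidalCategory AlgebraicGeometry

universe u

noncomputable section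

namespace NodalCurves

/-! ### Normalization of an integral scheme -/

/-- The inclusion of the generic point of an integral scheme is quasi-compact. -/
instance quasiCompact_fromSpecStalk_genericPoint (X : Scheme.{u}) [IsIntegral X] :
    QuasiCompact (X.fromSpecStalk (genericPoint X)) := by
  have h : Subsingleton (Spec (X.presheaf.stalk (genericPoint X))) :=
    inferInstanceAs (Subsingleton (PrimeSpectrum X.functionField))
  exact ⟨fun U _ _ => (Set.subsingleton_of_subsingleton).finite.isCompact⟩

/-- The normalization of an integral scheme `X`: the relative normalization of `X` in the
spectrum of its function field, that is, over an affine open `U` it is the spectrum of the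
integral closure of `Γ(X, U)` in the function field of `X`. -/
def normalization (X : Scheme.{u}) [IsIntegral X] : Scheme.{u} :=
  (X.fromSpecStalk (genericPoint X)).normalization

/-- The normalization morphism of an integral scheme. -/
def normalizationMap (X : Scheme.{u}) [IsIntegral X] : normalization X ⟶ X :=
  (X.fromSpecStalk (genericPoint X)).fromNormalization

/-- `f : Y ⟶ X` is the normalization of `X`: the scheme `X` is integral, and `f` is isomorphic,
as a scheme over `X`, to the normalization morphism of `X`. -/
def IsNormalization {Y X : Scheme.{u}} (f : Y ⟶ X) : Prop :=
  ∃ (_ : IsIntegral X) (e : Y ≅ normalization X), e.hom ≫ normalizationMap X = f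

/-! ### Irreducible nodal curves -/

/-- The complete local ring of a node, `k[[x, y]] / (x y)`. -/
abbrev NodeRing (k : Type u) [Field k] : Type u :=
  MvPowerSeries (Fin 2) k ⧸
    (Ideal.span {MvPowerSeries.X 0 * MvPowerSeries.X 1} : Ideal (MvPowerSeries (Fin 2) k))

/-- `x` is a node of the `k`-scheme `X`: the completion of the local ring of `X` at `x` is
isomorphic to `k[[x, y]] / (x y)`. (At a closed point of a scheme of finite type over an
algebraically closed field, a ring isomorphism exists if and only if a `k`-algebra isomorphism
does.) -/
def IsNode (k : Type u) [Field k] (X : Scheme.{u}) (x : X) : Prop :=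
  Nonempty (AdicCompletion (IsLocalRing.maximalIdeal (X.presheaf.stalk x))
    (X.presheaf.stalk x) ≃+* NodeRing k)

/-- An irreducible nodal curve over `k`: an integral, separated `k`-scheme of finite type and of
dimension one, each of whose closed points is either regular or a node. -/
structure IsIrreducibleNodalCurve {k : Type u} [Field k] (C : Over (Spec (.of k))) : Prop where
  isIntegral : IsIntegral C.left
  isSeparated : IsSeparated C.hom
  locallyOfFiniteType : LocallyOfFiniteType C.hom
  quasiCompact : QuasiCompact C.hom
  dim_eq_one : topologicalKrullDim C.left = 1
  regular_or_node : ∀ x : C.left, IsClosed {x} →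
    IsRegularLocalRing (C.left.presheaf.stalk x) ∨ IsNode k C.left x

/-! ### Projective schemes over a field -/

/-- Projective `n`-space over `k`, as a `k`-scheme. -/
def projectiveSpace (k : Type u) [Field k] (n : ℕ) : Over (Spec (.of k)) :=
  letI : GradedAlgebra (MvPolynomial.homogeneousSubmodule (Fin (n + 1)) k) :=
    MvPolynomial.gradedAlgebra
  Over.mk (Proj.toSpecZero (MvPolynomial.homogeneousSubmodule (Fin (n + 1)) k) ≫
    Spec.map (CommRingCat.ofHom
      (algebraMap k (MvPolynomial.homogeneousSubmodule (Fin (n + 1)) k 0))))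

/-- A `k`-scheme is projective if it is a closed subscheme of some projective space over `k`. -/
def IsProjective {k : Type u} [Field k] (X : Over (Spec (.of k))) : Prop :=
  ∃ (n : ℕ) (i : X ⟶ projectiveSpace k n), IsClosedImmersion i.left

/-! ### Symmetric squares -/

/-- `π : X ⟶ Q` is the quotient of `X` by the involution `σ`: the morphism `π` is affine
and `σ`-invariant, `Q` carries the quotient topology, the fibres of `π` are the orbits of `σ`,
and the sections of `𝒪_Q` over `U` are, via `π`, the `σ`-invariant sections of `𝒪_X` over
`π ⁻¹ U`. -/
structure IsQuotientByInvolution {X Q : Scheme.{u}} (σ : X ⟶ X) (π : X ⟶ Q) : Prop where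
  isAffineHom : IsAffineHom π
  invariant : σ ≫ π = π
  isQuotientMap : Topology.IsQuotientMap π
  orbit : ∀ x y : X, π x = π y → y = x ∨ y = σ x
  injective : ∀ U : Q.Opens, Function.Injective (π.app U)
  exists_of_invariant : ∀ (U : Q.Opens) (s : Γ(X, π ⁻¹ᵁ U)),
    σ.appLE (π ⁻¹ᵁ U) (π ⁻¹ᵁ U)
      (by rw [← Scheme.Hom.comp_preimage, invariant]) s = s → ∃ t : Γ(Q, U), π.app U t = s

/-- `π : C × C ⟶ S` exhibits the `k`-scheme `S` as the symmetric square of `C`, that is, as the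
quotient of the product `C × C` over `k` by the involution exchanging the two factors. -/
def IsSymmetricSquare {k : Type u} [Field k] {C S : Over (Spec (.of k))} (π : C ⊗ C ⟶ S) : Prop :=
  IsQuotientByInvolution (β_ C C).hom.left π.left

end NodalCurves

end

/-!
Products and quotients by involutions are determined by rings of sections on suitable affine opens,
and so is normalization: by `IsNormalization.isRingNormalization_app` and
`IsNormalization.of_forall_exists`, a morphism to an integral scheme is its normalization if and
only if, over the members of an affine open cover, it is affine and given by the normalization of a
domain (`IsRingNormalization`). Both parts of the theorem are thereby statements of commutative
algebra, valid for integral schemes locally of finite type over the algebraically closed field `k`.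

For products, let `A` and `B` be integrally closed `k`-domains whose fraction fields `K` and `L` are
finitely generated over `k`. The ring `A ⊗ B` is a domain because a finitely generated `k`-domain
has enough `k`-points (`isDomain_tensorProduct`). It is integrally closed
(`isIntegrallyClosed_tensorProduct`), being the intersection of `K ⊗ B` and `A ⊗ L` in `K ⊗ L`; and
`K ⊗ B` is integrally closed because a separating transcendence basis of `K` makes it étale over a
localization of a polynomial ring over `B`. Integrality and equality of fraction fields are clear
for tensor products of normalizations, which gives `IsNormalization.tensorHom` and, by induction on
the number of factors, `IsNormalization.piMap`.

For symmetric squares, the spectrum of the ring of invariants is the quotient of an affine scheme by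
an involution (`exists_isQuotientByInvolution_of_isAffine`). Being a quotient is local on the target
(`IsQuotientByInvolution.of_forall_exists`), and a quotient has its universal property among all
schemes (`IsQuotientByInvolution.exists_desc`). Hence quotients of stable open subsets glue, and a
quotient exists as soon as stable affine opens cover
(`exists_isQuotientByInvolution_of_isAffineOpen`). If `C` is projective, two of its points lie in a
common affine open `U`, and the opens `U × U` form such a cover of `C × C`. If `C` has a symmetric
square, the preimages of its affine opens form such a cover of the square of the normalization of
`C`, because `ν × ν` is integral and so affine.

The morphism `φ` is given by the universal property. Over an affine open of `C⁽²⁾` it is the map of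
invariants induced by the normalization `ν × ν` of `C × C`, and normalization of domains commutes
with invariants under an involution (`IsRingNormalization.invariants`): an element of the fraction
field integral over the invariants upstairs is integral, hence a section, and is itself invariant,
while a fraction `b / s` has the invariant denominator `s * τ s`. This is
`IsNormalization.of_isQuotient`.
-/

namespace NodalCurves

/-! ### Domains and integrally closed domains under tensor products -/

section Algebra

open TensorProduct

/-- Nullstellensatz for a finitely generated domain `A` over an algebraically closed field: a
nonzero element of `A` does not vanish at some `k`-point of `A`. -/
lemma exists_algHom_apply_ne_zero {k A : Type*} [Field k] [IsAlgClosed k] [CommRing A] [IsDomain A]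
    [Algebra k A] [Algebra.FiniteType k A] {a : A} (ha : a ≠ 0) :
    ∃ φ : A →ₐ[k] k, φ a ≠ 0 := by
  -- a residue field of `A[1/a]` is a finite extension of `k`, hence equal to `k`
  let L := Localization.Away a
  have : Nontrivial L := (IsLocalization.injective L
    (powers_le_nonZeroDivisors_of_noZeroDivisors ha)).nontrivial
  have : Algebra.FiniteType A L := IsLocalization.finiteType_of_monoid_fg (.powers a) L
  have : Algebra.FiniteType k L := .trans (S := A) inferInstance inferInstance
  obtain ⟨m, hm⟩ := Ideal.exists_maximal L
  let _ := Ideal.Quotient.field m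
  have : Algebra.FiniteType k (L ⧸ m) := .of_surjective (Ideal.Quotient.mkₐ k m)
    (Ideal.Quotient.mkₐ_surjective k m)
  have : Module.Finite k (L ⧸ m) := finite_of_finite_type_of_isJacobsonRing k (L ⧸ m)
  let e : k ≃ₐ[k] (L ⧸ m) := AlgEquiv.ofBijective (Algebra.ofId k _)
    IsAlgClosed.algebraMap_bijective_of_isIntegral
  let φ : L →ₐ[k] k := e.symm.toAlgHom.comp (Ideal.Quotient.mkₐ k m)
  refine ⟨φ.comp (IsScalarTower.toAlgHom k A L), ?_⟩
  exact ((IsLocalization.Away.algebraMap_isUnit (S := L) a).map φ).ne_zero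

/-- The case of a finitely generated factor of `isDomain_tensorProduct`: the product of two nonzero
tensors does not vanish at a `k`-point of `A` where one coefficient of each is nonzero. -/
lemma noZeroDivisors_tensorProduct_of_finiteType (k A B : Type*) [Field k] [IsAlgClosed k]
    [CommRing A] [IsDomain A] [CommRing B] [IsDomain B] [Algebra k A] [Algebra k B]
    [Algebra.FiniteType k A] : NoZeroDivisors (A ⊗[k] B) := by
  refine ⟨fun {x y} hxy ↦ ?_⟩
  by_contra! h
  let b := Module.Free.chooseBasis k B
  let bA := b.baseChange A
  obtain ⟨i, hi⟩ : ∃ i, bA.repr x i ≠ 0 := by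
    by_contra! H
    exact h.1 (bA.repr.injective (by ext i; simp [H]))
  obtain ⟨j, hj⟩ : ∃ j, bA.repr y j ≠ 0 := by
    by_contra! H
    exact h.2 (bA.repr.injective (by ext i; simp [H]))
  obtain ⟨φ, hφ⟩ := exists_algHom_apply_ne_zero (k := k) (mul_ne_zero hi hj)
  let Φ : A ⊗[k] B →ₐ[k] B := Algebra.TensorProduct.lift ((Algebra.ofId k B).comp φ)
    (AlgHom.id k B) fun _ _ ↦ .all _ _
  have key (z : A ⊗[k] B) (l) : b.repr (Φ z) l = φ (bA.repr z l) := by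
    induction z with
    | zero => simp
    | add x y hx hy => simp [hx, hy]
    | tmul a c =>
      have h : Φ (a ⊗ₜ c) = φ a • c := (Algebra.smul_def _ _).symm
      simp [h, bA, mul_comm]
  have h0 : Φ x * Φ y = 0 := by rw [← map_mul, hxy, map_zero]
  rw [map_mul] at hφ
  rcases mul_eq_zero.mp h0 with h0 | h0
  · exact left_ne_zero_of_mul hφ (by rw [← key, h0]; simp)
  · exact right_ne_zero_of_mul hφ (by rw [← key, h0]; simp)

/-- Over an algebraically closed field, the tensor product of two domains is a domain. -/
theorem isDomain_tensorProduct (k A B : Type*) [Field k] [IsAlgClosed k]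
    [CommRing A] [IsDomain A] [CommRing B] [IsDomain B] [Algebra k A] [Algebra k B] :
    IsDomain (A ⊗[k] B) := by
  have : NoZeroDivisors (A ⊗[k] B) := by
    refine ⟨fun {x y} hxy ↦ ?_⟩
    -- the two factors come from a finitely generated subalgebra of `A`
    obtain ⟨N, ⟨S, rfl⟩, hN⟩ := Submodule.exists_fg_le_subset_range_rTensor_subtype
      ({x, y} : Set (A ⊗[k] B)) (by simp)
    let A₀ := Algebra.adjoin k (S : Set A)
    have : Algebra.FiniteType k A₀ := (Subalgebra.fg_iff_finiteType _).mp ⟨S, rfl⟩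
    have := noZeroDivisors_tensorProduct_of_finiteType k A₀ B
    let f : A₀ ⊗[k] B →ₐ[k] A ⊗[k] B := Algebra.TensorProduct.map A₀.val (.id k B)
    have inj : Function.Injective f :=
      Module.Flat.rTensor_preserves_injective_linearMap A₀.val.toLinearMap Subtype.val_injective
    have hf : ∀ z ∈ ({x, y} : Set (A ⊗[k] B)), ∃ w, f w = z := by
      intro z hz
      obtain ⟨w, rfl⟩ := hN hz
      clear hz
      refine ⟨LinearMap.rTensor B (Submodule.inclusion (Algebra.span_le_adjoin k (S : Set A))) w,
        ?_⟩
      induction w with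
      | zero => simp
      | add x y hx hy => simp only [map_add, hx, hy]
      | tmul a b => rfl
    obtain ⟨x, rfl⟩ := hf x (by simp)
    obtain ⟨y, rfl⟩ := hf y (by simp)
    have h : x * y = 0 := inj (by rw [map_zero, map_mul]; exact hxy)
    rcases mul_eq_zero.mp h with rfl | rfl
    · exact .inl (map_zero _)
    · exact .inr (map_zero _)
  have : Nontrivial (A ⊗[k] B) := inferInstance
  exact NoZeroDivisors.to_isDomain _

/-- An étale extension of domains `R → S` with `R` integrally closed: `S` is integrally closed, as
forming integral closures commutes with the base change along `R → S` and `S ⊗[R] Frac R` is the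
fraction field of `S`. -/
theorem isIntegrallyClosed_of_etale (R S : Type*) [CommRing R] [CommRing S] [IsDomain R]
    [IsDomain S] [IsIntegrallyClosed R] [Algebra R S] [Algebra.Etale R S] [FaithfulSMul R S] :
    IsIntegrallyClosed S := by
  let K := FractionRing R
  let E := S ⊗[R] K
  -- `S ⊗[R] K` is a localization of `S`, and a field as it is finite over `K`
  have hloc : IsLocalization (Algebra.algebraMapSubmonoid S (nonZeroDivisors R)) E :=
    inferInstance
  have hle : Algebra.algebraMapSubmonoid S (nonZeroDivisors R) ≤ nonZeroDivisors S := by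
    rintro _ ⟨r, hr, rfl⟩
    refine mem_nonZeroDivisors_of_ne_zero ?_
    simpa using nonZeroDivisors.ne_zero hr
  have : IsDomain E := IsLocalization.isDomain_of_le_nonZeroDivisors _ hle
  let e : K ⊗[R] S ≃+* E := (Algebra.TensorProduct.comm R K S).toRingEquiv
  have : IsDomain (K ⊗[R] S) := e.toMulEquiv.isDomain E
  have : Module.Finite K (K ⊗[R] S) := Algebra.FormallyUnramified.finite_of_free K _
  have : IsField (K ⊗[R] S) := isField_of_isIntegral_of_isField' (R := K) (Field.toIsField K)
  have : IsField E := e.symm.toMulEquiv.isField this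
  let := this.toField
  have : FaithfulSMul S E :=
    (faithfulSMul_iff_algebraMap_injective S E).mpr (IsLocalization.injective E hle)
  have : IsFractionRing S E := by
    refine .of_field _ _ fun z ↦ ?_
    obtain ⟨s, t, rfl⟩ := IsLocalization.exists_mk'_eq
      (Algebra.algebraMapSubmonoid S (nonZeroDivisors R)) z
    refine ⟨s, t, ?_⟩
    rw [eq_div_iff, IsLocalization.mk'_spec]
    exact (IsLocalization.map_units E t).ne_zero
  rw [isIntegrallyClosed_iff E]
  intro x hx
  -- `x` is in the image of the base change to `S` of the integral closure of `R` in `K`, which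
  -- is `R`
  obtain ⟨y, hy⟩ :=
    (TensorProduct.toIntegralClosure_bijective_of_smooth (R := R) (S := S) (B := K)).2 ⟨x, hx⟩
  have : x ∈ Set.range (algebraMap S E) := by
    have h : (TensorProduct.toIntegralClosure R S K y : E) ∈ Set.range (algebraMap S E) := by
      clear hy
      induction y with
      | zero => exact ⟨0, by simp⟩
      | add a b ha hb =>
        obtain ⟨a', ha⟩ := ha
        obtain ⟨b', hb⟩ := hb
        exact ⟨a' + b', by rw [map_add, map_add, ha, hb]; rfl⟩
      | tmul s b =>
        obtain ⟨r, hr⟩ := (isIntegrallyClosed_iff K).mp ‹_› b.2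
        refine ⟨r • s, ?_⟩
        change _ = s ⊗ₜ[R] (b : K)
        rw [← hr, Algebra.algebraMap_eq_smul_one r, ← TensorProduct.smul_tmul]
        rfl
    rwa [hy] at h
  exact this

/-- Polynomials over the fraction field `K` of `R` form a unique factorization domain, and such a
polynomial is integral over the polynomials over `R` only if its coefficients are integral over
`R`. -/
theorem isIntegrallyClosed_mvPolynomial (R σ : Type*) [CommRing R] [IsDomain R]
    [IsIntegrallyClosed R] : IsIntegrallyClosed (MvPolynomial σ R) := by
  let K := FractionRing R
  let _ : Algebra (MvPolynomial σ R) (MvPolynomial σ K) := MvPolynomial.algebraMvPolynomial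
  have : IsIntegrallyClosed (MvPolynomial σ K) := inferInstance
  have : IsIntegrallyClosedIn (MvPolynomial σ R) (MvPolynomial σ K) := by
    refine isIntegrallyClosedIn_iff.mpr ⟨MvPolynomial.map_injective _
      (IsFractionRing.injective R K), fun {p} hp ↦ ?_⟩
    rw [MvPolynomial.isIntegral_iff_isIntegral_coeff] at hp
    have h n := (isIntegrallyClosed_iff K).mp ‹_› (hp n)
    refine (MvPolynomial.mem_range_map_iff_coeffs_subset (f := algebraMap R K)).mpr ?_
    intro c hc
    obtain ⟨n, -, rfl⟩ := MvPolynomial.mem_coeffs_iff.mp hc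
    exact h n
  exact .of_isIntegrallyClosed_of_isIntegrallyClosedIn _ (MvPolynomial σ K)

/-- Base change of an integrally closed `k`-domain `A₀ ⊗ B` to the fraction field `F` of `A₀`. -/
lemma isIntegrallyClosed_fractionRing_tensorProduct (k A₀ F B : Type*) [Field k] [IsAlgClosed k]
    [CommRing A₀] [IsDomain A₀] [Algebra k A₀] [Field F] [Algebra k F] [Algebra A₀ F]
    [IsScalarTower k A₀ F] [IsFractionRing A₀ F] [CommRing B] [IsDomain B] [Algebra k B]
    [IsIntegrallyClosed (A₀ ⊗[k] B)] : IsIntegrallyClosed (F ⊗[k] B) := by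
  have : IsDomain (A₀ ⊗[k] B) := isDomain_tensorProduct k A₀ B
  let f : A₀ ⊗[k] B →ₐ[k] F ⊗[k] B :=
    Algebra.TensorProduct.map (IsScalarTower.toAlgHom k A₀ F) (.id k B)
  let _ : Algebra (A₀ ⊗[k] B) (F ⊗[k] B) := RingHom.toAlgebra (f : A₀ ⊗[k] B →+* F ⊗[k] B)
  have : IsScalarTower A₀ (A₀ ⊗[k] B) (F ⊗[k] B) := .of_algebraMap_eq fun x ↦ by
    simp [RingHom.algebraMap_toAlgebra, f]
  have := IsLocalization.tensorProduct_tensorProduct k B (nonZeroDivisors A₀) F (by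
    ext x; simp [RingHom.algebraMap_toAlgebra, f])
  refine isIntegrallyClosed_of_isLocalization (R := A₀ ⊗[k] B) _
    (Algebra.algebraMapSubmonoid (A₀ ⊗[k] B) (nonZeroDivisors A₀)) ?_
  rintro _ ⟨r, hr, rfl⟩
  refine mem_nonZeroDivisors_of_ne_zero ?_
  rw [Ne, FaithfulSMul.algebraMap_eq_zero_iff]
  exact nonZeroDivisors.ne_zero hr

/-- Base change along a finite separable field extension `K / F` of an integrally closed domain. -/
lemma isIntegrallyClosed_tensorProduct_of_isSeparable (k F K B : Type*) [Field k] [IsAlgClosed k]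
    [Field F] [Field K] [Algebra k F] [Algebra k K] [Algebra F K] [IsScalarTower k F K]
    [Module.Finite F K] [Algebra.IsSeparable F K] [CommRing B] [IsDomain B] [Algebra k B]
    [IsIntegrallyClosed (F ⊗[k] B)] : IsIntegrallyClosed (K ⊗[k] B) := by
  have : IsDomain (K ⊗[k] B) := isDomain_tensorProduct k K B
  have : IsDomain (F ⊗[k] B) := isDomain_tensorProduct k F B
  have : Algebra.FinitePresentation F K := Algebra.FinitePresentation.of_finiteType.mp inferInstance
  have : Algebra.FormallyEtale F K := .of_isSeparable F K
  have : Algebra.Etale F K := {}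
  let e : (F ⊗[k] B) ⊗[F] K ≃+* K ⊗[k] B := (Algebra.TensorProduct.comm F _ _).toRingEquiv.trans
    (Algebra.TensorProduct.cancelBaseChange k F F K B).toRingEquiv
  have : IsDomain ((F ⊗[k] B) ⊗[F] K) := e.toMulEquiv.isDomain _
  have := isIntegrallyClosed_of_etale (F ⊗[k] B) ((F ⊗[k] B) ⊗[F] K)
  exact .of_equiv e

open IntermediateField.algebraAdjoinAdjoin in
/-- A separating transcendence basis `s` of `K` presents `K ⊗ B` as an étale algebra over
`k(s) ⊗ B`, which is a localization of the polynomial ring `B[s]`. -/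
theorem isIntegrallyClosed_field_tensorProduct (k K B : Type*) [Field k] [IsAlgClosed k] [Field K]
    [Algebra k K] [Algebra.EssFiniteType k K] [CommRing B] [IsDomain B] [IsIntegrallyClosed B]
    [Algebra k B] : IsIntegrallyClosed (K ⊗[k] B) := by
  obtain ⟨s, hs, hsep⟩ :=
    exists_isTranscendenceBasis_and_isSeparable_of_perfectField (k := k) (K := K)
  let e₀ : MvPolynomial s k ≃ₐ[k] Algebra.adjoin k (s : Set K) :=
    hs.1.aevalEquiv.trans (Subalgebra.equivOfEq _ _ (by simp))
  let e₁ : Algebra.adjoin k (s : Set K) ⊗[k] B ≃ₐ[k] MvPolynomial s B :=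
    (Algebra.TensorProduct.congr e₀.symm .refl).trans <| (Algebra.TensorProduct.comm k _ _).trans
      ((MvPolynomial.algebraTensorAlgEquiv k B).restrictScalars k)
  have := isIntegrallyClosed_mvPolynomial B s
  have : IsIntegrallyClosed (Algebra.adjoin k (s : Set K) ⊗[k] B) := .of_equiv e₁.symm.toRingEquiv
  have := isIntegrallyClosed_fractionRing_tensorProduct k (Algebra.adjoin k (s : Set K))
    (IntermediateField.adjoin k (s : Set K)) B
  have : Algebra.IsAlgebraic (IntermediateField.adjoin k (s : Set K)) K := inferInstance
  have : Algebra.EssFiniteType (IntermediateField.adjoin k (s : Set K)) K := .of_comp k _ K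
  have : Module.Finite (IntermediateField.adjoin k (s : Set K)) K :=
    Algebra.finite_of_essFiniteType_of_isAlgebraic
  exact isIntegrallyClosed_tensorProduct_of_isSeparable k
    (IntermediateField.adjoin k (s : Set K)) K B

/-- If every element of a domain `E` becomes an element of `R` after multiplication by a nonzero
element of `R`, then `R` and `E` have the same fraction field. -/
lemma isFractionRing_comp_of_forall_exists {R E M : Type*} [CommRing R] [CommRing E] [IsDomain E]
    [Field M] [Algebra E M] [IsFractionRing E M] (g : R →+* E) (hg : Function.Injective g)
    (hE : ∀ z, ∃ s, s ≠ 0 ∧ ∃ r, g s * z = g r) :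
    letI := ((algebraMap E M).comp g).toAlgebra
    IsFractionRing R M := by
  let _ := ((algebraMap E M).comp g).toAlgebra
  have : FaithfulSMul R M := (faithfulSMul_iff_algebraMap_injective R M).mpr
    ((IsFractionRing.injective E M).comp hg)
  refine .of_field _ _ fun z ↦ ?_
  obtain ⟨x, y, hy, rfl⟩ := IsFractionRing.div_surjective (A := E) z
  obtain ⟨s, hs, r, hr⟩ := hE x
  obtain ⟨s', hs', r', hr'⟩ := hE y
  refine ⟨s' * r, s * r', ?_⟩
  change _ = algebraMap E M (g _) / algebraMap E M (g _)
  have h1 : algebraMap E M (g s) ≠ 0 := by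
    rw [Ne, IsFractionRing.to_map_eq_zero_iff]
    exact fun h ↦ hs (hg (by simpa using h))
  have h2 : algebraMap E M (g s') ≠ 0 := by
    rw [Ne, IsFractionRing.to_map_eq_zero_iff]
    exact fun h ↦ hs' (hg (by simpa using h))
  rw [map_mul g, map_mul g, ← hr, ← hr']
  simp only [map_mul]
  have h3 : algebraMap E M y ≠ 0 := IsFractionRing.to_map_ne_zero_of_mem_nonZeroDivisors hy
  field_simp

/-- If `R` is the intersection, inside a domain `E` with the same fraction field, of two integrally
closed subrings, then `R` is integrally closed. -/
lemma isIntegrallyClosed_of_inter {R R₁ R₂ E : Type*} [CommRing R] [CommRing R₁] [CommRing R₂]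
    [CommRing E] [IsDomain R] [IsDomain E] [IsIntegrallyClosed R₁] [IsIntegrallyClosed R₂]
    (f₁ : R →+* R₁) (f₂ : R →+* R₂) (g₁ : R₁ →+* E) (g₂ : R₂ →+* E)
    (hf₁ : Function.Injective f₁) (hg₁ : Function.Injective g₁) (hg₂ : Function.Injective g₂)
    (hgf : g₁.comp f₁ = g₂.comp f₂) (hE : ∀ z, ∃ s, s ≠ 0 ∧ ∃ r, g₁ (f₁ s) * z = g₁ (f₁ r))
    (hR : ∀ y z, g₁ y = g₂ z → ∃ r, f₁ r = y) : IsIntegrallyClosed R := by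
  let M := FractionRing E
  let _ : Algebra R M := ((algebraMap E M).comp (g₁.comp f₁)).toAlgebra
  let _ : Algebra R₁ M := ((algebraMap E M).comp g₁).toAlgebra
  let _ : Algebra R₂ M := ((algebraMap E M).comp g₂).toAlgebra
  let _ := f₁.toAlgebra
  let _ := f₂.toAlgebra
  have hgf' (x) : g₁ (f₁ x) = g₂ (f₂ x) := congr($hgf x)
  have hf₂ : Function.Injective f₂ := by
    have : Function.Injective (g₂ ∘ f₂) := by
      convert hg₁.comp hf₁ using 1
      exact funext fun x ↦ (hgf' x).symm
    exact this.of_comp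
  have : IsFractionRing R M := isFractionRing_comp_of_forall_exists _ (hg₁.comp hf₁) hE
  have : IsFractionRing R₁ M := isFractionRing_comp_of_forall_exists _ hg₁ fun z ↦
    let ⟨s, hs, r, hr⟩ := hE z
    ⟨f₁ s, by rwa [Ne, map_eq_zero_iff _ hf₁], f₁ r, hr⟩
  have : IsFractionRing R₂ M := isFractionRing_comp_of_forall_exists _ hg₂ fun z ↦
    let ⟨s, hs, r, hr⟩ := hE z
    ⟨f₂ s, by rwa [Ne, map_eq_zero_iff _ hf₂], f₂ r, by rw [← hgf', ← hgf', hr]⟩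
  have : IsScalarTower R R₁ M := .of_algebraMap_eq fun _ ↦ rfl
  have : IsScalarTower R R₂ M := .of_algebraMap_eq fun x ↦ congr(algebraMap E M $(hgf' x))
  rw [isIntegrallyClosed_iff M]
  intro x hx
  obtain ⟨y, hy⟩ := (isIntegrallyClosed_iff M).mp ‹IsIntegrallyClosed R₁› hx.tower_top
  obtain ⟨z, hz⟩ := (isIntegrallyClosed_iff M).mp ‹IsIntegrallyClosed R₂› hx.tower_top
  obtain ⟨r, rfl⟩ := hR y z (IsFractionRing.injective E M (hy.trans hz.symm))
  exact ⟨r, hy⟩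

/-- The tensor product of two integrally closed domains with finitely generated fraction fields `K`
and `L` over an algebraically closed field is integrally closed: inside `K ⊗ L`, it is the
intersection of the integrally closed domains `K ⊗ B` and `A ⊗ L`. -/
theorem isIntegrallyClosed_tensorProduct (k A B K L : Type*) [Field k] [IsAlgClosed k]
    [CommRing A] [IsDomain A] [IsIntegrallyClosed A] [Algebra k A]
    [CommRing B] [IsDomain B] [IsIntegrallyClosed B] [Algebra k B]
    [Field K] [Algebra k K] [Algebra A K] [IsScalarTower k A K] [IsFractionRing A K]
    [Field L] [Algebra k L] [Algebra B L] [IsScalarTower k B L] [IsFractionRing B L]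
    [Algebra.EssFiniteType k K] [Algebra.EssFiniteType k L] :
    IsIntegrallyClosed (A ⊗[k] B) := by
  have := isDomain_tensorProduct k A B
  have := isDomain_tensorProduct k A L
  have := isDomain_tensorProduct k K B
  have := isDomain_tensorProduct k K L
  have := isIntegrallyClosed_field_tensorProduct k K B
  have : IsIntegrallyClosed (L ⊗[k] A) := isIntegrallyClosed_field_tensorProduct k L A
  have : IsIntegrallyClosed (A ⊗[k] L) := .of_equiv (Algebra.TensorProduct.comm k L A).toRingEquiv
  let i : A →ₐ[k] K := IsScalarTower.toAlgHom k A K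
  let j : B →ₐ[k] L := IsScalarTower.toAlgHom k B L
  have hi : Function.Injective i := IsFractionRing.injective A K
  have hj : Function.Injective j := IsFractionRing.injective B L
  let f₁ : A ⊗[k] B →ₐ[k] K ⊗[k] B := Algebra.TensorProduct.map i (.id k B)
  let f₂ : A ⊗[k] B →ₐ[k] A ⊗[k] L := Algebra.TensorProduct.map (.id k A) j
  let g₁ : K ⊗[k] B →ₐ[k] K ⊗[k] L := Algebra.TensorProduct.map (.id k K) j
  let g₂ : A ⊗[k] L →ₐ[k] K ⊗[k] L := Algebra.TensorProduct.map i (.id k L)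
  have hg₁ : Function.Injective g₁ :=
    Module.Flat.lTensor_preserves_injective_linearMap j.toLinearMap hj
  have hg₂ : Function.Injective g₂ :=
    Module.Flat.rTensor_preserves_injective_linearMap i.toLinearMap hi
  have hf₁ : Function.Injective f₁ :=
    Module.Flat.rTensor_preserves_injective_linearMap i.toLinearMap hi
  have hgf : g₁.comp f₁ = g₂.comp f₂ := by
    ext <;> simp [g₁, f₁, g₂, f₂]
  refine isIntegrallyClosed_of_inter f₁.toRingHom f₂.toRingHom g₁.toRingHom g₂.toRingHom hf₁ hg₁ hg₂
    (congr_arg AlgHom.toRingHom hgf) (fun z ↦ ?_) fun y z hyz ↦ ?_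
  · change ∃ s : A ⊗[k] B, s ≠ 0 ∧ ∃ r, g₁ (f₁ s) * z = g₁ (f₁ r)
    induction z with
    | zero => exact ⟨1, one_ne_zero, 0, by simp⟩
    | add x y hx hy =>
      obtain ⟨s, hs, r, hr⟩ := hx
      obtain ⟨s', hs', r', hr'⟩ := hy
      refine ⟨s * s', mul_ne_zero hs hs', s' * r + s * r', ?_⟩
      simp only [map_mul, map_add, ← hr, ← hr']
      ring
    | tmul x y =>
      obtain ⟨a, s, hs, rfl⟩ := IsFractionRing.div_surjective (A := A) x
      obtain ⟨b, t, ht, rfl⟩ := IsFractionRing.div_surjective (A := B) y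
      have hs' : algebraMap A K s ≠ 0 :=
        IsFractionRing.to_map_ne_zero_of_mem_nonZeroDivisors hs
      have ht' : algebraMap B L t ≠ 0 :=
        IsFractionRing.to_map_ne_zero_of_mem_nonZeroDivisors ht
      have e : g₁ (f₁ (s ⊗ₜ t)) * ((algebraMap A K a / algebraMap A K s) ⊗ₜ[k]
          (algebraMap B L b / algebraMap B L t)) = g₁ (f₁ (a ⊗ₜ b)) := by
        simp [g₁, f₁, i, j, Algebra.TensorProduct.tmul_mul_tmul, mul_div_cancel₀, hs', ht']
      refine ⟨s ⊗ₜ t, fun h ↦ ?_, a ⊗ₜ b, e⟩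
      have h' : (algebraMap A K s) ⊗ₜ[k] (algebraMap B L t) = 0 := by
        simpa [g₁, f₁, i, j] using congr(g₁ (f₁ $h))
      have h'' : (algebraMap A K s ⊗ₜ[k] (1 : L)) * ((1 : K) ⊗ₜ[k] algebraMap B L t) = 0 := by
        simpa [Algebra.TensorProduct.tmul_mul_tmul] using h'
      rcases mul_eq_zero.mp h'' with h | h
      · exact hs' (Algebra.TensorProduct.includeLeft_injective (R := k) (S := k) (A := K) (B := L)
          (algebraMap k L).injective (by simpa using h))
      · exact ht' (Algebra.TensorProduct.includeRight_injective (R := k) (A := K) (B := L)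
          (algebraMap k K).injective (by simpa using h))
  -- a `k`-linear retraction of `A → K` maps the given element of `K ⊗ B` to the required one
  -- of `A ⊗ B`
  · replace hyz : g₁ y = g₂ z := hyz
    obtain ⟨r, hr⟩ := i.toLinearMap.exists_leftInverse_of_injective (LinearMap.ker_eq_bot.mpr hi)
    have h₁ (y : K ⊗[k] B) : f₂ (r.rTensor B y) = r.rTensor L (g₁ y) := by
      induction y with
      | zero => simp
      | add x y hx hy => simp only [map_add, hx, hy]
      | tmul x b => rfl
    have h₂ (z : A ⊗[k] L) : r.rTensor L (g₂ z) = z := by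
      induction z with
      | zero => simp
      | add x y hx hy => simp only [map_add, hx, hy]
      | tmul x b => exact congr($(LinearMap.congr_fun hr x) ⊗ₜ b)
    refine ⟨r.rTensor B y, hg₁ ?_⟩
    calc g₁ (f₁ (r.rTensor B y)) = g₂ (f₂ (r.rTensor B y)) := congr($hgf _)
      _ = g₁ y := by rw [h₁, hyz, h₂]

end Algebra

/-! ### Normalization of domains -/

section RingNormalization

open TensorProduct

lemma isIntegralElem_of_comp_eq {A B A' B' : Type*} [CommRing A] [CommRing B] [CommRing A']
    [CommRing B'] {φ : A →+* B} {φ' : A' →+* B'} {u : A →+* A'} {v : B →+* B'}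
    (e : φ'.comp u = v.comp φ) {b : B} (hb : φ.IsIntegralElem b) : φ'.IsIntegralElem (v b) := by
  obtain ⟨p, hp, hp'⟩ := hb
  exact ⟨p.map u, hp.map _, by rw [Polynomial.eval₂_map, e, ← Polynomial.hom_eval₂, hp', map_zero]⟩

/-- A ring is integral over its ring of invariants under an involution. -/
lemma isIntegral_of_invariant {A B : Type*} [CommRing A] [CommRing B] (φ : B →+* A)
    (τ : A →+* A) (hτ : ∀ a, τ (τ a) = a) (ex : ∀ a, τ a = a → ∃ x, φ x = a) : φ.IsIntegral := by
  intro a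
  -- `a` is a root of `T² - (a + τ a) T + a τ a`, whose coefficients are invariant
  obtain ⟨s, hs⟩ := ex (a + τ a) (by rw [map_add, hτ, add_comm])
  obtain ⟨t, ht⟩ := ex (a * τ a) (by rw [map_mul, hτ, mul_comm])
  refine ⟨Polynomial.X ^ 2 - Polynomial.C s * Polynomial.X + Polynomial.C t, by monicity!, ?_⟩
  simp only [Polynomial.eval₂_add, Polynomial.eval₂_sub, Polynomial.eval₂_mul, Polynomial.eval₂_pow,
    Polynomial.eval₂_X, Polynomial.eval₂_C, hs, ht]
  ring

/-- `φ : A → B` is the normalization of the domain `A`: the ring `B` is an integrally closed domain,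
integral over its subring `A`, all of whose elements are fractions of elements of `A`. -/
structure IsRingNormalization {A B : Type*} [CommRing A] [CommRing B] (φ : A →+* B) : Prop where
  isDomain : IsDomain B
  isIntegrallyClosed : IsIntegrallyClosed B
  injective : Function.Injective φ
  isIntegral : φ.IsIntegral
  exists_eq : ∀ b, ∃ s, s ≠ 0 ∧ ∃ a, φ s * b = φ a

namespace IsRingNormalization

variable {A B C : Type*} [CommRing A] [CommRing B] [CommRing C]

lemma isDomain_source {φ : A →+* B} (h : IsRingNormalization φ) : IsDomain A :=
  have := h.isDomain
  h.injective.isDomain φ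

lemma map_ne_zero {φ : A →+* B} (h : IsRingNormalization φ) {a : A} (ha : a ≠ 0) : φ a ≠ 0 := by
  rwa [Ne, map_eq_zero_iff _ h.injective]

lemma comp_ringEquiv {φ : A →+* B} (h : IsRingNormalization φ) (e : C ≃+* A) :
    IsRingNormalization (φ.comp (e : C →+* A)) where
  isDomain := h.isDomain
  isIntegrallyClosed := h.isIntegrallyClosed
  injective := h.injective.comp e.injective
  isIntegral := (RingHom.isIntegral_of_surjective _ e.surjective).trans _ _ h.isIntegral
  exists_eq b := by
    obtain ⟨s, hs, a, ha⟩ := h.exists_eq b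
    exact ⟨e.symm s, by simpa using hs, e.symm a, by simpa using ha⟩

lemma ringEquiv_comp {φ : A →+* B} (h : IsRingNormalization φ) (e : B ≃+* C) :
    IsRingNormalization ((e : B →+* C).comp φ) where
  isDomain := have := h.isDomain; e.symm.toMulEquiv.isDomain B
  isIntegrallyClosed := have := h.isIntegrallyClosed; .of_equiv e
  injective := e.injective.comp h.injective
  isIntegral := h.isIntegral.trans _ _ (RingHom.isIntegral_of_surjective _ e.surjective)
  exists_eq b := by
    obtain ⟨s, hs, a, ha⟩ := h.exists_eq (e.symm b)
    exact ⟨s, hs, a, by simpa using congr(e $ha)⟩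

/-- The integral closure of a domain in its fraction field is its normalization. -/
lemma algebraMap_integralClosure (A K : Type*) [CommRing A] [Field K] [Algebra A K]
    [IsFractionRing A K] : IsRingNormalization (algebraMap A (integralClosure A K)) where
  isDomain := inferInstance
  isIntegrallyClosed := by
    have : IsFractionRing (integralClosure A K) K := by
      refine .of_field _ _ fun z ↦ ?_
      obtain ⟨x, y, -, rfl⟩ := IsFractionRing.div_surjective (A := A) z
      exact ⟨algebraMap A _ x, algebraMap A _ y, rfl⟩
    rw [isIntegrallyClosed_iff K]
    intro x hx
    exact ⟨⟨x, isIntegral_trans x hx⟩, rfl⟩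
  injective x y h := IsFractionRing.injective A K congr(($h : K))
  isIntegral := algebraMap_isIntegral_iff.mpr inferInstance
  exists_eq b := by
    have : IsDomain A := (IsFractionRing.injective A K).isDomain (algebraMap A K)
    obtain ⟨x, y, hy, h⟩ := IsFractionRing.div_surjective (A := A) (b : K)
    refine ⟨y, nonZeroDivisors.ne_zero hy, x, Subtype.ext ?_⟩
    change algebraMap A K y * (b : K) = algebraMap A K x
    rw [← h, mul_div_cancel₀ _ (IsFractionRing.to_map_ne_zero_of_mem_nonZeroDivisors hy)]

/-- The fraction field of the normalization of `A` is the fraction field of `A`. -/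
lemma isFractionRing {φ : A →+* B} (h : IsRingNormalization φ) (K : Type*) [Field K] [Algebra B K]
    [IsFractionRing B K] :
    letI := ((algebraMap B K).comp φ).toAlgebra
    IsFractionRing A K :=
  have := h.isDomain
  isFractionRing_comp_of_forall_exists φ h.injective h.exists_eq

/-- The normalization of `A` maps to every field containing `A`. -/
lemma exists_lift {φ : A →+* B} (h : IsRingNormalization φ) {K : Type*} [Field K] (f : A →+* K)
    (hf : Function.Injective f) : ∃ g : B →+* K, g.comp φ = f := by
  have := h.isDomain
  have := h.isDomain_source
  let L := FractionRing B
  let _ := ((algebraMap B L).comp φ).toAlgebra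
  have := h.isFractionRing L
  refine ⟨(IsFractionRing.lift (A := A) (K := L) hf).comp (algebraMap B L), ?_⟩
  ext a
  exact IsFractionRing.lift_algebraMap hf a

/-- A morphism between two normalizations of `A` is an isomorphism: it is injective as both have the
same fraction field, and surjective as the source is integrally closed. -/
lemma bijective_of_comp_eq {φ : A →+* B} {ψ : A →+* C} (h : IsRingNormalization φ)
    (h' : IsRingNormalization ψ) (g : B →+* C) (hg : g.comp φ = ψ) : Function.Bijective g := by
  have := h.isDomain
  have := h'.isDomain
  have := h.isIntegrallyClosed
  have hg' (a) : g (φ a) = ψ a := congr($hg a)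
  have inj : Function.Injective g := by
    rw [injective_iff_map_eq_zero]
    intro b hb
    obtain ⟨s, hs, a, ha⟩ := h.exists_eq b
    have : ψ a = 0 := by rw [← hg', ← ha, map_mul, hb, mul_zero]
    rw [map_eq_zero_iff _ h'.injective] at this
    rw [this, map_zero] at ha
    exact (mul_eq_zero.mp ha).resolve_left (h.map_ne_zero hs)
  refine ⟨inj, fun c ↦ ?_⟩
  obtain ⟨s, hs, a, ha⟩ := h'.exists_eq c
  let L := FractionRing B
  let M := FractionRing C
  have inj' : Function.Injective ((algebraMap C M).comp g) :=
    (IsFractionRing.injective C M).comp inj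
  let i : L →+* M := IsFractionRing.lift inj'
  have hi (b) : i (algebraMap B L b) = algebraMap C M (g b) := IsFractionRing.lift_algebraMap inj' b
  have hs' : algebraMap B L (φ s) ≠ 0 := by
    rw [Ne, IsFractionRing.to_map_eq_zero_iff]
    exact h.map_ne_zero hs
  let x : L := algebraMap B L (φ a) / algebraMap B L (φ s)
  have hx : i x = algebraMap C M c := by
    rw [map_div₀, hi, hi, hg', hg', ← ha, map_mul, mul_div_cancel_left₀]
    rw [Ne, IsFractionRing.to_map_eq_zero_iff]
    exact h'.map_ne_zero hs
  have hint : IsIntegral B x := by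
    obtain ⟨p, hp, hp'⟩ := h'.isIntegral c
    refine ⟨p.map φ, hp.map _, i.injective ?_⟩
    have e : (i.comp (algebraMap B L)).comp φ = (algebraMap C M).comp ψ := by
      ext a
      exact (hi _).trans congr(algebraMap C M $(hg' a))
    rw [Polynomial.hom_eval₂, Polynomial.eval₂_map, e, hx, ← Polynomial.hom_eval₂, hp', map_zero,
      map_zero]
  obtain ⟨b, hb⟩ := (isIntegrallyClosed_iff L).mp ‹_› hint
  exact ⟨b, IsFractionRing.injective C M (by rw [← hi, hb, hx])⟩

lemma essFiniteType_fractionRing {k : Type*} [Field k] [Algebra k A] [Algebra k B]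
    [Algebra.FiniteType k A] [IsDomain B] {φ : A →ₐ[k] B} (h : IsRingNormalization φ.toRingHom) :
    Algebra.EssFiniteType k (FractionRing B) := by
  let _ : Algebra A (FractionRing B) := ((algebraMap B (FractionRing B)).comp φ.toRingHom).toAlgebra
  have : IsScalarTower k A (FractionRing B) := .of_algebraMap_eq fun x ↦ by
    change _ = algebraMap B _ (φ _)
    rw [φ.commutes]
    rfl
  have := h.isFractionRing (FractionRing B)
  have : Algebra.EssFiniteType A (FractionRing B) := .of_isLocalization _ (nonZeroDivisors A)
  exact .comp k A _

/-- Over an algebraically closed field, normalization commutes with tensor products of finitely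
generated domains. -/
lemma tensorProduct (k : Type*) [Field k] [IsAlgClosed k] {A A' B B' : Type*} [CommRing A]
    [CommRing A'] [CommRing B] [CommRing B'] [Algebra k A] [Algebra k A'] [Algebra k B]
    [Algebra k B'] [Algebra.FiniteType k A] [Algebra.FiniteType k A'] (φ : A →ₐ[k] B)
    (φ' : A' →ₐ[k] B') (h : IsRingNormalization φ.toRingHom)
    (h' : IsRingNormalization φ'.toRingHom) :
    IsRingNormalization (Algebra.TensorProduct.map φ φ').toRingHom := by
  have := h.isDomain
  have := h'.isDomain
  have := h.isDomain_source
  have := h'.isDomain_source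
  have := h.isIntegrallyClosed
  have := h'.isIntegrallyClosed
  have hd := isDomain_tensorProduct k B B'
  have hd' := isDomain_tensorProduct k A A'
  let f := Algebra.TensorProduct.map φ φ'
  have inj : Function.Injective f := by
    have e : f = (Algebra.TensorProduct.map φ (.id k B')).comp
        (Algebra.TensorProduct.map (.id k A) φ') := by
      ext <;> simp [f]
    rw [e]
    exact (Module.Flat.rTensor_preserves_injective_linearMap φ.toLinearMap h.injective).comp
      (Module.Flat.lTensor_preserves_injective_linearMap φ'.toLinearMap h'.injective)
  refine ⟨hd, ?_, inj, ?_, fun z ↦ ?_⟩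
  · have := h.essFiniteType_fractionRing
    have := h'.essFiniteType_fractionRing
    exact isIntegrallyClosed_tensorProduct k B B' (FractionRing B) (FractionRing B')
  · intro z
    induction z with
    | zero => exact RingHom.isIntegralElem_zero _
    | add x y hx hy => exact hx.add _ hy
    | tmul x y =>
      have e : x ⊗ₜ[k] y = (x ⊗ₜ 1) * (1 ⊗ₜ y) := by simp
      rw [e]
      refine RingHom.IsIntegralElem.mul _ ?_ ?_
      · exact isIntegralElem_of_comp_eq (φ := φ.toRingHom)
          (u := (Algebra.TensorProduct.includeLeft : A →ₐ[k] A ⊗[k] A').toRingHom)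
          (v := (Algebra.TensorProduct.includeLeft : B →ₐ[k] B ⊗[k] B').toRingHom)
          (by ext; simp) (h.isIntegral x)
      · exact isIntegralElem_of_comp_eq (φ := φ'.toRingHom)
          (u := (Algebra.TensorProduct.includeRight : A' →ₐ[k] A ⊗[k] A').toRingHom)
          (v := (Algebra.TensorProduct.includeRight : B' →ₐ[k] B ⊗[k] B').toRingHom)
          (by ext; simp) (h'.isIntegral y)
  · change ∃ s, s ≠ 0 ∧ ∃ a, f s * z = f a
    induction z with
    | zero => exact ⟨1, one_ne_zero, 0, by simp⟩
    | add x y hx hy =>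
      obtain ⟨s, hs, r, hr⟩ := hx
      obtain ⟨s', hs', r', hr'⟩ := hy
      refine ⟨s * s', mul_ne_zero hs hs', s' * r + s * r', ?_⟩
      simp only [map_mul, map_add, ← hr, ← hr']
      ring
    | tmul x y =>
      obtain ⟨s, hs, a, ha⟩ := h.exists_eq x
      obtain ⟨t, ht, b, hb⟩ := h'.exists_eq y
      refine ⟨s ⊗ₜ t, ?_, a ⊗ₜ b, ?_⟩
      · have e : s ⊗ₜ[k] t = (s ⊗ₜ 1) * (1 ⊗ₜ t) := by simp
        rw [e]
        refine mul_ne_zero (fun h ↦ hs ?_) (fun h ↦ ht ?_)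
        · exact Algebra.TensorProduct.includeLeft_injective (R := k) (S := k) (A := A) (B := A')
            (algebraMap k A').injective (by simpa using h)
        · exact Algebra.TensorProduct.includeRight_injective (R := k) (A := A) (B := A')
            (algebraMap k A).injective (by simpa using h)
      · replace ha : φ s * x = φ a := ha
        replace hb : φ' t * y = φ' b := hb
        simp [f, ha, hb]

/-- Normalization commutes with taking invariants under an involution: if `φ : B → B'` is the
normalization and is compatible with involutions of `B` and `B'`, then so is the map of rings of
invariants. The rings of invariants are given as the sources of injections `i` and `i'`. -/
lemma invariants {A A' B B' : Type*} [CommRing A]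
    [CommRing A'] [CommRing B] [CommRing B'] {i : A →+* B} {i' : A' →+* B'} {φ : B →+* B'}
    {ψ : A →+* A'} {τ : B →+* B} {τ' : B' →+* B'} (h : IsRingNormalization φ)
    (hτ : ∀ b, τ (τ b) = b) (hφ : ∀ b, φ (τ b) = τ' (φ b)) (hψ : ∀ a, i' (ψ a) = φ (i a))
    (hi : Function.Injective i) (hi' : Function.Injective i')
    (hi₁ : ∀ a, τ (i a) = i a) (hi₂ : ∀ b, τ b = b → ∃ a, i a = b)
    (hi₁' : ∀ a, τ' (i' a) = i' a) (hi₂' : ∀ b, τ' b = b → ∃ a, i' a = b) :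
    IsRingNormalization ψ := by
  have := h.isDomain
  have := h.isDomain_source
  have := h.isIntegrallyClosed
  have : IsDomain A' := hi'.isDomain i'
  have inj : Function.Injective ψ := by
    have : Function.Injective (i' ∘ ψ) := by
      convert h.injective.comp hi using 1
      exact funext hψ
    exact this.of_comp
  have hψ' : i'.comp ψ = φ.comp i := RingHom.ext hψ
  have hint : i.IsIntegral := isIntegral_of_invariant i τ hτ hi₂
  refine ⟨‹_›, ?_, inj, fun a' ↦ ?_, fun a' ↦ ?_⟩
  -- an element of `Frac A'` integral over `A'` lies in `B'`, and it is invariant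
  · let L := FractionRing A'
    let M := FractionRing B'
    have inj' : Function.Injective ((algebraMap B' M).comp i') :=
      (IsFractionRing.injective B' M).comp hi'
    let j : L →+* M := IsFractionRing.lift inj'
    have hj (a) : j (algebraMap A' L a) = algebraMap B' M (i' a) :=
      IsFractionRing.lift_algebraMap inj' a
    rw [isIntegrallyClosed_iff L]
    intro x hx
    obtain ⟨b, hb⟩ : ∃ b, algebraMap B' M b = j x := by
      refine (isIntegrallyClosed_iff M).mp ‹_› ?_
      obtain ⟨p, hp, hp'⟩ := hx
      refine ⟨p.map i', hp.map _, ?_⟩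
      have e : (algebraMap B' M).comp i' = j.comp (algebraMap A' L) :=
        RingHom.ext fun a ↦ (hj a).symm
      rw [Polynomial.eval₂_map, e, ← Polynomial.hom_eval₂, hp', map_zero]
    obtain ⟨a, s, hs, rfl⟩ := IsFractionRing.div_surjective (A := A') x
    have hs' : i' s ≠ 0 := by
      rw [Ne, map_eq_zero_iff _ hi']
      exact nonZeroDivisors.ne_zero hs
    have e : i' s * b = i' a := by
      refine IsFractionRing.injective B' M ?_
      rw [map_mul, hb, map_div₀, hj, hj, mul_div_cancel₀]
      rwa [Ne, IsFractionRing.to_map_eq_zero_iff]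
    obtain ⟨c, rfl⟩ := hi₂' b <| mul_left_cancel₀ hs' <| by
      conv_lhs => rw [← hi₁' s, ← map_mul, e, hi₁', ← e]
    exact ⟨c, j.injective (by rw [hj, hb])⟩
  · have : (φ.comp i).IsIntegral := hint.trans _ _ h.isIntegral
    obtain ⟨p, hp, hp'⟩ := this (i' a')
    refine ⟨p, hp, hi' ?_⟩
    rw [Polynomial.hom_eval₂, hψ', hp', map_zero]
  -- a fraction `b / s` is rewritten with the invariant denominator `s * τ s`
  · obtain ⟨s, hs, b, hb⟩ := h.exists_eq (i' a')
    obtain ⟨n, hn⟩ := hi₂ (s * τ s) (by rw [map_mul, hτ, mul_comm])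
    have e : φ (b * τ s) = φ (i n) * i' a' := by rw [hn, map_mul, map_mul, ← hb]; ring
    obtain ⟨c, hc⟩ := hi₂ (b * τ s) <| h.injective <| by
      rw [hφ, e, map_mul, hi₁', ← hφ, hi₁]
    have hτs : τ s ≠ 0 := fun h0 ↦ hs (by rw [← hτ s, h0, map_zero])
    refine ⟨n, fun h0 ↦ mul_ne_zero hs hτs (by rw [← hn, h0, map_zero]), c, hi' ?_⟩
    rw [map_mul, hψ, hψ, hc, e]

end IsRingNormalization

end RingNormalization

/-! ### Normalization of schemes on affine opens -/

section NormalizationCriterion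

/-- A version of `IsRingNormalization.algebraMap_integralClosure` for a commutative ring which is a
field only propositionally, such as the sections of a spectrum. -/
lemma IsRingNormalization.algebraMap_integralClosure_of_isField (A K : Type*) [CommRing A]
    [CommRing K] [Algebra A K] [IsFractionRing A K] (hK : IsField K) :
    IsRingNormalization (algebraMap A (integralClosure A K)) := by
  let _ := hK.toField
  exact .algebraMap_integralClosure A K

variable {X Y : Scheme.{u}}

lemma bijective_presheaf_map_eqToHom {U V : X.Opens} (e : U = V) :
    Function.Bijective (X.presheaf.map (eqToHom e).op).hom := by
  subst e
  simp [Function.bijective_id]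

lemma genericPoint_mem [IsIntegral X] (U : X.Opens) [Nonempty U] : genericPoint X ∈ U :=
  ((genericPoint_spec X).mem_open_set_iff U.isOpen).mpr (by simpa using ‹Nonempty U›)

/-- The preimage of a nonempty open subset in the spectrum of the function field is everything. -/
lemma isIso_fromSpecStalk_comparison [IsIntegral X] (U : X.Opens) [Nonempty U] :
    IsIso ((Spec (X.presheaf.stalk (genericPoint X))).presheaf.map
      (homOfLE (le_top : X.fromSpecStalk (genericPoint X) ⁻¹ᵁ U ≤ ⊤)).op) := by
  have : X.fromSpecStalk (genericPoint X) ⁻¹ᵁ U = ⊤ := by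
    refine top_le_iff.mp fun x _ ↦ ?_
    have h : X.fromSpecStalk (genericPoint X) x ⤳ genericPoint X :=
      X.range_fromSpecStalk.le ⟨x, rfl⟩
    have h' : X.fromSpecStalk (genericPoint X) x = genericPoint X :=
      (h.antisymm (genericPoint_specializes _)).eq
    change X.fromSpecStalk (genericPoint X) x ∈ U
    rw [h']
    exact genericPoint_mem U
  have : IsIso (homOfLE (le_top : X.fromSpecStalk (genericPoint X) ⁻¹ᵁ U ≤ ⊤)) :=
    ⟨homOfLE this.ge, rfl, rfl⟩
  infer_instance

/-- Over a nonempty affine open, the normalization of an integral scheme is the normalization of the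
ring of sections. -/
lemma isRingNormalization_normalizationMap_app [IsIntegral X] {U : X.Opens} (hU : IsAffineOpen U)
    [Nonempty U] : IsRingNormalization ((normalizationMap X).app U).hom := by
  let j := X.fromSpecStalk (genericPoint X)
  let A := Γ(X, U)
  let K := X.functionField
  let L := Γ(Spec (X.presheaf.stalk (genericPoint X)), j ⁻¹ᵁ U)
  let _ : Algebra A L := (j.app U).hom.toAlgebra
  have := isIso_fromSpecStalk_comparison U
  let e : K ≃+* L := ((Scheme.ΓSpecIso (X.presheaf.stalk (genericPoint X))).symm ≪≫
    asIso ((Spec (X.presheaf.stalk (genericPoint X))).presheaf.map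
      (homOfLE (le_top : j ⁻¹ᵁ U ≤ ⊤)).op)).commRingCatIsoToRingEquiv
  have := functionField_isFractionRing_of_isAffineOpen X U hU
  let e' : K ≃ₐ[A] L := AlgEquiv.ofRingEquiv (f := e) fun a ↦
    congr($(Scheme.fromSpecStalk_app (genericPoint_mem U)) a).symm
  have : IsFractionRing A L := IsLocalization.isLocalization_of_algEquiv _ e'
  have hL : IsField L := e.symm.toMulEquiv.isField (Field.toIsField K)
  have h := IsRingNormalization.algebraMap_integralClosure_of_isField A L hL
  have h' := h.ringEquiv_comp (Scheme.Hom.normalizationObjIso j hU).symm.commRingCatIsoToRingEquiv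
  have eq : (normalizationMap X).app U = _ := Scheme.Hom.fromNormalization_app j hU
  rw [eq]
  exact h'

instance [IsIntegral X] : IsIntegralHom (normalizationMap X) :=
  inferInstanceAs (IsIntegralHom (X.fromSpecStalk (genericPoint X)).fromNormalization)

lemma IsNormalization.isIntegral {f : Y ⟶ X} (hf : IsNormalization f) : IsIntegral X := hf.1

lemma IsNormalization.isIntegralHom {f : Y ⟶ X} (hf : IsNormalization f) : IsIntegralHom f := by
  obtain ⟨_, e, rfl⟩ := hf
  infer_instance

lemma IsNormalization.isRingNormalization_app {f : Y ⟶ X} (hf : IsNormalization f) {U : X.Opens}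
    (hU : IsAffineOpen U) [Nonempty U] : IsRingNormalization (f.app U).hom := by
  obtain ⟨_, e, rfl⟩ := hf
  rw [Scheme.Hom.comp_app]
  exact (isRingNormalization_normalizationMap_app hU).ringEquiv_comp
    (asIso (e.hom.app _)).commRingCatIsoToRingEquiv

/-- A morphism to an integral scheme is the normalization if it is so on affine open
neighbourhoods of all points. -/
theorem IsNormalization.of_forall_exists [IsIntegral X] {f : Y ⟶ X}
    (hf : ∀ x : X, ∃ U : X.Opens, x ∈ U ∧ IsAffineOpen U ∧ IsAffineOpen (f ⁻¹ᵁ U) ∧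
      IsRingNormalization (f.app U).hom) : IsNormalization f := by
  have : IsAffineHom f := isAffineHom_of_forall_exists_isAffineOpen f fun x ↦
    let ⟨U, hx, hU, hU', _⟩ := hf x
    ⟨U, hx, hU, hU'⟩
  have : IsIntegralHom f := by
    choose U hx hU hU' h using hf
    refine (@HasAffineProperty.iff_of_iSup_eq_top _ _ IsIntegralHom.hasAffineProperty.{u} _ _ f _
      (fun x ↦ ⟨U x, hU x⟩)
      (top_le_iff.mp fun x _ ↦ TopologicalSpace.Opens.mem_iSup.mpr ⟨x, hx x⟩)).mpr fun x ↦
      ⟨hU' x, ?_⟩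
    have h' (V : X.Opens) (hV : V = U x) : (f.app V).hom.IsIntegral := by
      subst hV
      exact (h x).isIntegral
    have e := morphismRestrict_appTop f (U x)
    rw [Scheme.Hom.appTop] at e
    rw [e]
    exact (h' _ (U x).ι_image_top).trans _ _ (RingHom.isIntegral_of_surjective _
      (bijective_presheaf_map_eqToHom _).2)
  let j := X.fromSpecStalk (genericPoint X)
  -- the generic point of `X` lifts to `Y`
  obtain ⟨i, hi⟩ : ∃ i : Spec (X.presheaf.stalk (genericPoint X)) ⟶ Y, j = i ≫ f := by
    obtain ⟨U, hx, hU, hU', h⟩ := hf (genericPoint X)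
    have : Nonempty U := ⟨_, hx⟩
    obtain ⟨g, hg⟩ : ∃ g : Γ(Y, f ⁻¹ᵁ U) ⟶ X.presheaf.stalk (genericPoint X),
        f.app U ≫ g = X.presheaf.germ U (genericPoint X) hx := by
      obtain ⟨g, hg⟩ := h.exists_lift (K := X.functionField) _ (X.germToFunctionField_injective U)
      exact ⟨CommRingCat.ofHom g, CommRingCat.hom_ext hg⟩
    refine ⟨Spec.map g ≫ hU'.fromSpec, ?_⟩
    rw [Category.assoc, ← IsAffineOpen.SpecMap_appLE_fromSpec f hU hU' le_rfl,
      ← Spec.map_comp_assoc, ← Scheme.Hom.app_eq_appLE, hg]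
    exact (hU.fromSpecStalk_eq_fromSpecStalk hx).symm
  -- the relative normalization maps to every integral `X`-scheme through which `j` factors
  let d : normalization X ⟶ Y := j.normalizationDesc i f hi
  have hd : d ≫ f = normalizationMap X := j.normalizationDesc_comp i f hi
  have : IsAffineHom d := by
    have : IsAffineHom (d ≫ f) := hd ▸ inferInstance
    exact .of_comp d f
  have : IsIso d := by
    refine IsZariskiLocalAtTarget.of_forall_exists_morphismRestrict (P := .isomorphisms _)
      fun y ↦ ?_
    obtain ⟨U, hx, hU, hU', h⟩ := hf (f y)
    have : Nonempty U := ⟨_, hx⟩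
    refine ⟨f ⁻¹ᵁ U, hx, (isIso_morphismRestrict_iff_isIso_app _ hU').mpr ?_⟩
    rw [ConcreteCategory.isIso_iff_bijective]
    have h' : IsRingNormalization ((d ≫ f).app U).hom := by
      rw [hd]
      exact isRingNormalization_normalizationMap_app hU
    refine h.bijective_of_comp_eq h' _ ?_
    rw [Scheme.Hom.comp_app]
    rfl
  exact ⟨‹_›, (asIso d).symm, by simp [← hd]⟩

end NormalizationCriterion

/-! ### Tensor products by their universal property -/

section Pushout

variable {k : Type u} [Field k] [IsAlgClosed k]

lemma isDomain_of_isPushout {A A' P : CommRingCat.{u}} {a : .of k ⟶ A} {a' : .of k ⟶ A'}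
    {p : A ⟶ P} {p' : A' ⟶ P} (h : IsPushout a a' p p') (hA : IsDomain A) (hA' : IsDomain A') :
    IsDomain P := by
  let _ : Algebra k A := a.hom.toAlgebra
  let _ : Algebra k A' := a'.hom.toAlgebra
  have := isDomain_tensorProduct k A A'
  exact (IsPushout.isoIsPushout A A' h
    (CommRingCat.isPushout_tensorProduct k A A')).commRingCatIsoToRingEquiv.toMulEquiv.isDomain _

/-- Over an algebraically closed field, the tensor product of two normalizations of algebras of
finite type is a normalization; here for tensor products known by their universal property. -/
lemma IsRingNormalization.of_isPushout {A A' B B' P Q : CommRingCat.{u}}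
    {a : .of k ⟶ A} {a' : .of k ⟶ A'} {p : A ⟶ P} {p' : A' ⟶ P} (hP : IsPushout a a' p p')
    {b : .of k ⟶ B} {b' : .of k ⟶ B'} {q : B ⟶ Q} {q' : B' ⟶ Q} (hQ : IsPushout b b' q q')
    {φ : A ⟶ B} {φ' : A' ⟶ B'} {χ : P ⟶ Q} (ha : a ≫ φ = b) (ha' : a' ≫ φ' = b')
    (hp : p ≫ χ = φ ≫ q) (hp' : p' ≫ χ = φ' ≫ q')
    (hfa : a.hom.FiniteType) (hfa' : a'.hom.FiniteType)
    (h : IsRingNormalization φ.hom) (h' : IsRingNormalization φ'.hom) :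
    IsRingNormalization χ.hom := by
  let _ : Algebra k A := a.hom.toAlgebra
  let _ : Algebra k A' := a'.hom.toAlgebra
  let _ : Algebra k B := b.hom.toAlgebra
  let _ : Algebra k B' := b'.hom.toAlgebra
  have : Algebra.FiniteType k A := hfa
  have : Algebra.FiniteType k A' := hfa'
  let f : A →ₐ[k] B := { φ.hom with commutes' x := congr($ha x) }
  let f' : A' →ₐ[k] B' := { φ'.hom with commutes' x := congr($ha' x) }
  have hT := CommRingCat.isPushout_tensorProduct k A A'
  have hT' := CommRingCat.isPushout_tensorProduct k B B'
  let e := IsPushout.isoIsPushout A A' hP hT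
  let e' := IsPushout.isoIsPushout B B' hT' hQ
  have key : IsRingNormalization (Algebra.TensorProduct.map f f').toRingHom :=
    .tensorProduct k f f' h h'
  have : χ = e.hom ≫ CommRingCat.ofHom (Algebra.TensorProduct.map f f').toRingHom ≫ e'.hom := by
    refine hP.hom_ext ?_ ?_
    · have h₁ : CommRingCat.ofHom
            (Algebra.TensorProduct.includeLeftRingHom : A →+* TensorProduct k A A') ≫
          CommRingCat.ofHom (Algebra.TensorProduct.map f f').toRingHom =
          φ ≫ CommRingCat.ofHom Algebra.TensorProduct.includeLeftRingHom := by
        ext x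
        change f x ⊗ₜ[k] f' 1 = f x ⊗ₜ[k] 1
        rw [map_one]
      rw [hp, IsPushout.inl_isoIsPushout_hom_assoc, reassoc_of% h₁, IsPushout.inl_isoIsPushout_hom]
    · have h₁ : CommRingCat.ofHom
            (Algebra.TensorProduct.includeRight : A' →ₐ[k] TensorProduct k A A').toRingHom ≫
          CommRingCat.ofHom (Algebra.TensorProduct.map f f').toRingHom =
          φ' ≫ CommRingCat.ofHom
            (Algebra.TensorProduct.includeRight : B' →ₐ[k] TensorProduct k B B').toRingHom := by
        ext x
        change f 1 ⊗ₜ[k] f' x = 1 ⊗ₜ[k] f' x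
        rw [map_one]
      rw [hp', IsPushout.inr_isoIsPushout_hom_assoc, reassoc_of% h₁, IsPushout.inr_isoIsPushout_hom]
  rw [this]
  exact (key.ringEquiv_comp e'.commRingCatIsoToRingEquiv).comp_ringEquiv e.commRingCatIsoToRingEquiv

end Pushout

/-! ### Products of affine opens -/

section Product

variable {k : Type u} [Field k]

/-- The `k`-algebra structure on the sections of a `k`-scheme. -/
noncomputable def sectionsAlgebraMap (C : Over (Spec (.of k))) (U : C.left.Opens) :
    .of k ⟶ Γ(C.left, U) :=
  (Scheme.ΓSpecIso (.of k)).inv ≫ C.hom.appLE ⊤ U (by simp)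

lemma sectionsAlgebraMap_appLE {N C : Over (Spec (.of k))} (ν : N ⟶ C) {U : C.left.Opens}
    {V : N.left.Opens} (h : V ≤ ν.left ⁻¹ᵁ U) :
    sectionsAlgebraMap C U ≫ ν.left.appLE U V h = sectionsAlgebraMap N V := by
  have e := Scheme.Hom.appLE_comp_appLE ν.left C.hom ⊤ U V (by simp) h
  simp_rw [Over.w ν] at e
  exact (Category.assoc _ _ _).trans congr((Scheme.ΓSpecIso (.of k)).inv ≫ $e)

lemma finiteType_sectionsAlgebraMap (C : Over (Spec (.of k))) [LocallyOfFiniteType C.hom]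
    {U : C.left.Opens} (hU : IsAffineOpen U) : (sectionsAlgebraMap C U).hom.FiniteType := by
  have := C.hom.finiteType_appLE (isAffineOpen_top _) hU le_top
  exact this.comp (.of_surjective _
    (Scheme.ΓSpecIso (.of k)).symm.commRingCatIsoToRingEquiv.surjective)

/-- The open subset `U × V` of a product of `k`-schemes. -/
noncomputable def prodOpen {C C' : Over (Spec (.of k))} (U : C.left.Opens) (V : C'.left.Opens) :
    (C ⊗ C').left.Opens :=
  (SemiCartesianMonoidalCategory.fst C C').left ⁻¹ᵁ U ⊓
    (SemiCartesianMonoidalCategory.snd C C').left ⁻¹ᵁ V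

variable {C C' : Over (Spec (.of k))} {U : C.left.Opens} {V : C'.left.Opens}

lemma prodOpen_le_fst :
    prodOpen U V ≤ (SemiCartesianMonoidalCategory.fst C C').left ⁻¹ᵁ U := inf_le_left

lemma prodOpen_le_snd :
    prodOpen U V ≤ (SemiCartesianMonoidalCategory.snd C C').left ⁻¹ᵁ V := inf_le_right

lemma isPullback_fst_snd (C C' : Over (Spec (.of k))) :
    IsPullback (SemiCartesianMonoidalCategory.fst C C').left
      (SemiCartesianMonoidalCategory.snd C C').left C.hom C'.hom :=
  IsPullback.of_hasPullback C.hom C'.hom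

lemma isAffineOpen_prodOpen (hU : IsAffineOpen U) (hV : IsAffineOpen V) :
    IsAffineOpen (prodOpen U V) := by
  have h := Scheme.Hom.isPullback_resLE (isPullback_fst_snd C C') (US := ⊤) (UX := U) (UT := V)
    le_top le_top (UY := prodOpen U V) rfl
  have : IsAffine U := hU
  have : IsAffine V := hV
  have : IsAffine (⊤ : (Spec (.of k)).Opens) := isAffineOpen_top _
  exact .of_isIso h.isoPullback.hom

/-- The sections over `U × V` are the tensor product of the sections over `U` and over `V`. -/
lemma isPushout_prodOpen (hU : IsAffineOpen U) (hV : IsAffineOpen V) :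
    IsPushout (sectionsAlgebraMap C U) (sectionsAlgebraMap C' V)
      ((SemiCartesianMonoidalCategory.fst C C').left.appLE U (prodOpen U V) prodOpen_le_fst)
      ((SemiCartesianMonoidalCategory.snd C C').left.appLE V (prodOpen U V) prodOpen_le_snd) := by
  have h := (isIso_pushoutSection_iff _ _ _ _).mp
    (isIso_pushoutSection_of_isAffineOpen (isPullback_fst_snd C C') (US := ⊤) (UX := U) (UT := V)
    le_top le_top (UY := prodOpen U V) rfl (isAffineOpen_top _) hV hU)
  exact h.of_iso (Scheme.ΓSpecIso (.of k)) (Iso.refl _) (Iso.refl _) (Iso.refl _)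
    (by simp [sectionsAlgebraMap]) (by simp [sectionsAlgebraMap]) (by simp) (by simp)

end Product

/-! ### Invariance of normalization under isomorphisms -/

section Isomorphisms

variable {X Y X' Y' : Scheme.{u}}

lemma IsNormalization.of_iso {f : Y ⟶ X} {f' : Y' ⟶ X'} (hf : IsNormalization f) (e : Y' ≅ Y)
    (e' : X ≅ X') (h : f' = e.hom ≫ f ≫ e'.hom) : IsNormalization f' := by
  subst h
  have := hf.isIntegral
  have := hf.isIntegralHom
  have : IsIntegral X' := .of_isIso e'.hom
  refine .of_forall_exists fun x ↦ ?_
  obtain ⟨U, hU, hx, -⟩ := exists_isAffineOpen_mem_and_subset (U := ⊤) (x := x) trivial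
  have hU' : IsAffineOpen (e'.hom ⁻¹ᵁ U) := hU.preimage_of_isIso _
  have : Nonempty (e'.hom ⁻¹ᵁ U) := ⟨e'.inv x, by
    change e'.hom (e'.inv x) ∈ U
    simpa⟩
  refine ⟨U, hx, hU, (hU'.preimage f).preimage_of_isIso e.hom, ?_⟩
  rw [Scheme.Hom.comp_app, Scheme.Hom.comp_app]
  exact ((hf.isRingNormalization_app hU').comp_ringEquiv
    (asIso (e'.hom.app U)).commRingCatIsoToRingEquiv).ringEquiv_comp
    (asIso (e.hom.app _)).commRingCatIsoToRingEquiv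

lemma isRingNormalization_app_iff {f : Y ⟶ X} {U : X.Opens} {V : Y.Opens} (h : V = f ⁻¹ᵁ U) :
    IsRingNormalization (f.app U).hom ↔ IsRingNormalization (f.appLE U V h.le).hom := by
  subst h
  rw [Scheme.Hom.app_eq_appLE]

end Isomorphisms

/-! ### Integral schemes from affine covers -/

section Integral

lemma nonempty_of_nontrivial_sections {X : Scheme.{u}} {W : X.Opens} [Nontrivial Γ(X, W)] :
    (W : Set X).Nonempty := by
  by_contra! h
  obtain rfl : W = ⊥ := SetLike.coe_injective h
  exact not_subsingleton Γ(X, ⊥) inferInstance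

variable {X : Scheme.{u}}

lemma isIntegral_toScheme {W : X.Opens} (hW : IsAffineOpen W) [IsDomain Γ(X, W)] :
    IsIntegral W := by
  have : IsAffine W := hW
  have : Nonempty W := Set.nonempty_coe_sort.mpr nonempty_of_nontrivial_sections
  have : IsDomain Γ(W, ⊤) := W.topIso.commRingCatIsoToRingEquiv.toMulEquiv.isDomain _
  exact isIntegral_of_isAffine_of_isDomain _

/-- A nonempty scheme covered by pairwise intersecting integral affine opens is integral. -/
lemma isIntegral_of_forall_exists [Nonempty X] (p : X.Opens → Prop)
    (hp : ∀ W, p W → IsAffineOpen W ∧ IsDomain Γ(X, W)) (hx : ∀ x : X, ∃ W, p W ∧ x ∈ W)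
    (hne : ∀ W W', p W → p W' → ((W : Set X) ∩ W').Nonempty) : IsIntegral X := by
  have hi (W : X.Opens) (h : p W) : IsPreirreducible (W : Set X) := by
    obtain ⟨h₁, h₂⟩ := hp W h
    have := isIntegral_toScheme h₁
    have h₃ := (PreirreducibleSpace.isPreirreducible_univ (X := W)).image W.ι
      W.ι.continuous.continuousOn
    rwa [Set.image_univ, W.range_ι] at h₃
  have : IsReduced X := by
    have (x : X) : _root_.IsReduced (X.presheaf.stalk x) := by
      obtain ⟨W, hW, hxW⟩ := hx x
      obtain ⟨h₁, h₂⟩ := hp W hW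
      have := isIntegral_toScheme h₁
      have : IsReduced W := inferInstance
      have := isReduced_stalk_of_isReduced (X := W) ⟨x, hxW⟩
      exact isReduced_of_injective _ (W.stalkIso ⟨x, hxW⟩).symm.commRingCatIsoToRingEquiv.injective
    exact isReduced_of_isReduced_stalk X
  have : IrreducibleSpace X :=
    { toPreirreducibleSpace := ⟨fun O O' hO hO' ⟨x, _, hxO⟩ ⟨x', _, hxO'⟩ ↦ by
        obtain ⟨W, hW, hxW⟩ := hx x
        obtain ⟨W', hW', hxW'⟩ := hx x'
        obtain ⟨y, hy, hy'⟩ := hne W W' hW hW'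
        obtain ⟨z, hz, hzO, hz'⟩ := hi W hW O W' hO W'.isOpen ⟨x, hxW, hxO⟩ ⟨y, hy, hy'⟩
        obtain ⟨t, _, ht⟩ := hi W' hW' O O' hO hO' ⟨z, hz', hzO⟩ ⟨x', hxW', hxO'⟩
        exact ⟨t, trivial, ht⟩⟩
      toNonempty := ‹_› }
  exact isIntegral_of_irreducibleSpace_of_isReduced X

end Integral

/-! ### Products of normalizations -/

section Product

variable {k : Type u} [Field k] [IsAlgClosed k] {C C' N N' : Over (Spec (.of k))}

open SemiCartesianMonoidalCategory (fst snd)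

omit [IsAlgClosed k] in
lemma exists_mem_prodOpen (z : (C ⊗ C').left) : ∃ (U : C.left.Opens) (V : C'.left.Opens),
    IsAffineOpen U ∧ IsAffineOpen V ∧ z ∈ prodOpen U V := by
  obtain ⟨U, hU, hx, -⟩ :=
    exists_isAffineOpen_mem_and_subset (U := ⊤) (x := (fst C C').left z) trivial
  obtain ⟨V, hV, hy, -⟩ :=
    exists_isAffineOpen_mem_and_subset (U := ⊤) (x := (snd C C').left z) trivial
  exact ⟨U, V, hU, hV, hx, hy⟩

lemma isDomain_prodOpen [IsIntegral C.left] [IsIntegral C'.left] {U : C.left.Opens}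
    {V : C'.left.Opens} (hU : IsAffineOpen U) (hV : IsAffineOpen V) [Nonempty U] [Nonempty V] :
    IsDomain Γ((C ⊗ C').left, prodOpen U V) :=
  isDomain_of_isPushout (isPushout_prodOpen hU hV) inferInstance inferInstance

/-- Over an algebraically closed field, the product of two integral schemes is integral. -/
lemma isIntegral_tensorObj [IsIntegral C.left] [IsIntegral C'.left] :
    IsIntegral (C ⊗ C').left := by
  -- products of nonempty open subsets meet, as they contain a product of nonempty affine opens,
  -- whose ring of sections is a domain
  have key {U₁ U₂ : C.left.Opens} {V₁ V₂ : C'.left.Opens} (h₁ : (U₁ : Set C.left).Nonempty)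
      (h₂ : (U₂ : Set C.left).Nonempty)
      (h₁' : (V₁ : Set C'.left).Nonempty) (h₂' : (V₂ : Set C'.left).Nonempty) :
      (((prodOpen U₁ V₁ : (C ⊗ C').left.Opens) : Set (C ⊗ C').left) ∩ prodOpen U₂ V₂).Nonempty := by
    obtain ⟨x, hx⟩ := nonempty_preirreducible_inter U₁.isOpen U₂.isOpen h₁ h₂
    obtain ⟨y, hy⟩ := nonempty_preirreducible_inter V₁.isOpen V₂.isOpen h₁' h₂'
    obtain ⟨U, hU, hxU, hU'⟩ := exists_isAffineOpen_mem_and_subset (U := U₁ ⊓ U₂) hx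
    obtain ⟨V, hV, hxV, hV'⟩ := exists_isAffineOpen_mem_and_subset (U := V₁ ⊓ V₂) hy
    have : Nonempty U := ⟨x, hxU⟩
    have : Nonempty V := ⟨y, hxV⟩
    have := isDomain_prodOpen hU hV
    obtain ⟨z, hz, hz'⟩ := nonempty_of_nontrivial_sections (W := prodOpen U V)
    exact ⟨z, ⟨(hU' hz).1, (hV' hz').1⟩, ⟨(hU' hz).2, (hV' hz').2⟩⟩
  have : Nonempty (C ⊗ C').left := by
    obtain ⟨z, -⟩ := key (U₁ := ⊤) (U₂ := ⊤) (V₁ := ⊤) (V₂ := ⊤) Set.univ_nonempty Set.univ_nonempty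
      Set.univ_nonempty Set.univ_nonempty
    exact ⟨z⟩
  refine isIntegral_of_forall_exists (fun W ↦ ∃ (U : C.left.Opens) (V : C'.left.Opens),
    IsAffineOpen U ∧ IsAffineOpen V ∧ Nonempty U ∧ Nonempty V ∧ W = prodOpen U V) ?_ ?_ ?_
  · rintro _ ⟨U, V, hU, hV, _, _, rfl⟩
    exact ⟨isAffineOpen_prodOpen hU hV, isDomain_prodOpen hU hV⟩
  · intro z
    obtain ⟨U, V, hU, hV, hz⟩ := exists_mem_prodOpen z
    exact ⟨_, ⟨U, V, hU, hV, ⟨_, hz.1⟩, ⟨_, hz.2⟩, rfl⟩, hz⟩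
  · rintro _ _ ⟨U, V, hU, hV, hU₀, hV₀, rfl⟩ ⟨U', V', hU', hV', hU₀', hV₀', rfl⟩
    exact key (Set.nonempty_coe_sort.mp hU₀) (Set.nonempty_coe_sort.mp hU₀')
      (Set.nonempty_coe_sort.mp hV₀) (Set.nonempty_coe_sort.mp hV₀')

instance locallyOfFiniteType_tensorObj [LocallyOfFiniteType C.hom] [LocallyOfFiniteType C'.hom] :
    LocallyOfFiniteType (C ⊗ C').hom :=
  inferInstanceAs (LocallyOfFiniteType (pullback.fst C.hom C'.hom ≫ C.hom))

omit [IsAlgClosed k] in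
lemma preimage_prodOpen (ν : N ⟶ C) (ν' : N' ⟶ C') (U : C.left.Opens) (V : C'.left.Opens) :
    prodOpen (ν.left ⁻¹ᵁ U) (ν'.left ⁻¹ᵁ V) = (ν ⊗ₘ ν').left ⁻¹ᵁ prodOpen U V := by
  have h₁ : (ν ⊗ₘ ν').left ≫ (fst C C').left = (fst N N').left ≫ ν.left := by
    rw [← Over.comp_left, ← Over.comp_left, CartesianMonoidalCategory.tensorHom_fst]
  have h₂ : (ν ⊗ₘ ν').left ≫ (snd C C').left = (snd N N').left ≫ ν'.left := by
    rw [← Over.comp_left, ← Over.comp_left, CartesianMonoidalCategory.tensorHom_snd]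
  rw [prodOpen, prodOpen, Scheme.Hom.preimage_inf, ← Scheme.Hom.comp_preimage,
    ← Scheme.Hom.comp_preimage, ← Scheme.Hom.comp_preimage, ← Scheme.Hom.comp_preimage, h₁, h₂]

/-- Over an algebraically closed field, the product of the normalizations of two integral schemes
locally of finite type is the normalization of the product. -/
theorem IsNormalization.tensorHom {ν : N ⟶ C} {ν' : N' ⟶ C'} [LocallyOfFiniteType C.hom]
    [LocallyOfFiniteType C'.hom] (h : IsNormalization ν.left) (h' : IsNormalization ν'.left) :
    IsNormalization (ν ⊗ₘ ν').left := by
  have := h.isIntegral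
  have := h'.isIntegral
  have := h.isIntegralHom
  have := h'.isIntegralHom
  have := isIntegral_tensorObj (C := C) (C' := C')
  refine .of_forall_exists fun z ↦ ?_
  obtain ⟨U, V, hU, hV, hz⟩ := exists_mem_prodOpen z
  have : Nonempty U := ⟨_, hz.1⟩
  have : Nonempty V := ⟨_, hz.2⟩
  have e := preimage_prodOpen ν ν' U V
  refine ⟨_, hz, isAffineOpen_prodOpen hU hV, ?_, ?_⟩
  · rw [← e]
    exact isAffineOpen_prodOpen (hU.preimage _) (hV.preimage _)
  rw [isRingNormalization_app_iff e]
  refine .of_isPushout (isPushout_prodOpen hU hV)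
    (isPushout_prodOpen (hU.preimage ν.left) (hV.preimage ν'.left))
    (φ := ν.left.app U) (φ' := ν'.left.app V) ?_ ?_ ?_ ?_
    (finiteType_sectionsAlgebraMap C hU) (finiteType_sectionsAlgebraMap C' hV)
    (h.isRingNormalization_app hU) (h'.isRingNormalization_app hV)
  · rw [Scheme.Hom.app_eq_appLE, sectionsAlgebraMap_appLE]
  · rw [Scheme.Hom.app_eq_appLE, sectionsAlgebraMap_appLE]
  · have h₁ : (ν ⊗ₘ ν').left ≫ (fst C C').left = (fst N N').left ≫ ν.left := by
      rw [← Over.comp_left, ← Over.comp_left, CartesianMonoidalCategory.tensorHom_fst]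
    rw [Scheme.Hom.app_eq_appLE, Scheme.Hom.appLE_comp_appLE, Scheme.Hom.appLE_comp_appLE]
    simp_rw [h₁]
  · have h₂ : (ν ⊗ₘ ν').left ≫ (snd C C').left = (snd N N').left ≫ ν'.left := by
      rw [← Over.comp_left, ← Over.comp_left, CartesianMonoidalCategory.tensorHom_snd]
    rw [Scheme.Hom.app_eq_appLE, Scheme.Hom.appLE_comp_appLE, Scheme.Hom.appLE_comp_appLE]
    simp_rw [h₂]

/-- The product of a finite family, with one factor split off. -/
noncomputable def piOptionIso {ι : Type} [Finite ι] (C : Option ι → Over (Spec (.of k))) :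
    ∏ᶜ C ≅ C none ⊗ ∏ᶜ fun i ↦ C (some i) where
  hom := CartesianMonoidalCategory.lift (Pi.π C none) (Pi.lift fun i ↦ Pi.π C (some i))
  inv := Pi.lift (f := C) fun
    | none => fst _ _
    | some i => snd _ _ ≫ Pi.π (fun i ↦ C (some i)) i
  hom_inv_id := by
    refine Pi.hom_ext _ _ fun i ↦ ?_
    cases i <;> simp
  inv_hom_id := by
    refine CartesianMonoidalCategory.hom_ext _ _ ?_ ?_
    · simp
    · refine Pi.hom_ext _ _ fun i ↦ ?_
      simp

omit [IsAlgClosed k] in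
lemma IsNormalization.of_iso_over {f : N ⟶ C} {f' : N' ⟶ C'} (hf : IsNormalization f.left)
    (e : N' ≅ N) (e' : C ≅ C') (h : e.hom ≫ f = f' ≫ e'.inv) : IsNormalization f'.left := by
  refine hf.of_iso ((Over.forget _).mapIso e) ((Over.forget _).mapIso e') ?_
  have : f' = e.hom ≫ f ≫ e'.hom := by rw [reassoc_of% h, Iso.inv_hom_id, Category.comp_id]
  rw [this]
  rfl

omit [IsAlgClosed k] in
lemma locallyOfFiniteType_of_iso (e : C ≅ C') [LocallyOfFiniteType C'.hom] :
    LocallyOfFiniteType C.hom := by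
  have : IsIso e.hom.left := inferInstanceAs (IsIso ((Over.forget _).map e.hom))
  have : LocallyOfFiniteType e.hom.left := inferInstance
  have h := locallyOfFiniteType_comp e.hom.left C'.hom
  exact (Over.w e.hom) ▸ h

omit [IsAlgClosed k] in
lemma isNormalization_id_tensorUnit :
    IsNormalization (Over.Hom.left (𝟙 (𝟙_ (Over (Spec (CommRingCat.of k)))))) := by
  change IsNormalization (𝟙 (Spec (CommRingCat.of k)))
  refine .of_forall_exists fun x ↦ ⟨⊤, trivial, isAffineOpen_top _, isAffineOpen_top _, ?_⟩
  rw [Scheme.Hom.id_app]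
  have : IsField Γ(Spec (.of k), ⊤) :=
    (Scheme.ΓSpecIso (.of k)).commRingCatIsoToRingEquiv.toMulEquiv.isField (Field.toIsField k)
  let _ := this.toField
  exact
    { isDomain := inferInstanceAs (IsDomain Γ(Spec (.of k), ⊤))
      isIntegrallyClosed := inferInstanceAs (IsIntegrallyClosed Γ(Spec (.of k), ⊤))
      injective := Function.injective_id
      isIntegral := RingHom.isIntegral_of_surjective _ Function.surjective_id
      exists_eq := fun b ↦ ⟨1, one_ne_zero, b, one_mul b⟩ }

omit [IsAlgClosed k] in
lemma IsNormalization.piMap_of_isEmpty {ι : Type} [IsEmpty ι] (C N : ι → Over (Spec (.of k)))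
    (ν : ∀ i, N i ⟶ C i) : IsNormalization (Limits.Pi.map ν : ∏ᶜ N ⟶ ∏ᶜ C).left ∧
      LocallyOfFiniteType (∏ᶜ C).hom := by
  let e (D : ι → Over (Spec (.of k))) : ∏ᶜ D ≅ 𝟙_ (Over (Spec (.of k))) :=
    { hom := SemiCartesianMonoidalCategory.toUnit _
      inv := Pi.lift fun i ↦ isEmptyElim i
      hom_inv_id := Pi.hom_ext _ _ fun i ↦ isEmptyElim i
      inv_hom_id := SemiCartesianMonoidalCategory.toUnit_unique _ _ }
  refine ⟨isNormalization_id_tensorUnit.of_iso_over (e N) (e C).symm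
    (SemiCartesianMonoidalCategory.toUnit_unique _ _), ?_⟩
  have : LocallyOfFiniteType (𝟙_ (Over (Spec (.of k)))).hom :=
    inferInstanceAs (LocallyOfFiniteType (𝟙 (Spec (CommRingCat.of k))))
  exact locallyOfFiniteType_of_iso (e C)

omit [IsAlgClosed k] in
lemma IsNormalization.piMap_of_equiv {ι ι' : Type} [Finite ι] [Finite ι'] (e : ι ≃ ι')
    (C N : ι' → Over (Spec (.of k))) (ν : ∀ i, N i ⟶ C i)
    (h : IsNormalization (Limits.Pi.map fun i ↦ ν (e i)).left)
    (h' : LocallyOfFiniteType (∏ᶜ fun i ↦ C (e i)).hom) :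
    IsNormalization (Limits.Pi.map ν : ∏ᶜ N ⟶ ∏ᶜ C).left ∧ LocallyOfFiniteType (∏ᶜ C).hom := by
  refine ⟨h.of_iso_over (Pi.reindex e N).symm (Pi.reindex e C) ?_, ?_⟩
  · rw [Iso.symm_hom, Iso.inv_comp_eq, ← Category.assoc, Iso.eq_comp_inv]
    refine Pi.hom_ext _ _ fun i ↦ ?_
    obtain ⟨i, rfl⟩ := e.surjective i
    rw [Category.assoc, Category.assoc, Pi.reindex_hom_π, Limits.Pi.map_π,
      ← Category.assoc, Pi.reindex_hom_π]
    exact Limits.Pi.map_π _ _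
  · have : LocallyOfFiniteType (∏ᶜ C ∘ e).hom := h'
    exact locallyOfFiniteType_of_iso (Pi.reindex e C).symm

lemma IsNormalization.piMap_option {ι : Type} [Finite ι]
    (C N : Option ι → Over (Spec (.of k))) (ν : ∀ i, N i ⟶ C i)
    [LocallyOfFiniteType (C none).hom] (h₀ : IsNormalization (ν none).left)
    (h : IsNormalization (Limits.Pi.map fun i ↦ ν (some i)).left)
    (h' : LocallyOfFiniteType (∏ᶜ fun i ↦ C (some i)).hom) :
    IsNormalization (Limits.Pi.map ν : ∏ᶜ N ⟶ ∏ᶜ C).left ∧ LocallyOfFiniteType (∏ᶜ C).hom := by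
  refine ⟨(h₀.tensorHom h).of_iso_over (piOptionIso N) (piOptionIso C).symm ?_, ?_⟩
  · refine CartesianMonoidalCategory.hom_ext _ _ ?_ ?_
    · simp [piOptionIso]
    · refine Pi.hom_ext _ _ fun i ↦ ?_
      simp [piOptionIso]
  · exact locallyOfFiniteType_of_iso (piOptionIso C)

/-- Over an algebraically closed field, a finite product of normalizations of integral schemes
locally of finite type is the normalization of the product. -/
theorem IsNormalization.piMap (ι : Type) [Finite ι] (C N : ι → Over (Spec (.of k)))
    (ν : ∀ i, N i ⟶ C i) (hC : ∀ i, LocallyOfFiniteType (C i).hom)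
    (hν : ∀ i, IsNormalization (ν i).left) :
    IsNormalization (Limits.Pi.map ν : ∏ᶜ N ⟶ ∏ᶜ C).left ∧ LocallyOfFiniteType (∏ᶜ C).hom := by
  revert C N
  refine Finite.induction_empty_option (P := fun ι ↦
    ∀ (_ : Finite ι) (C N : ι → Over (Spec (.of k))) (ν : ∀ i, N i ⟶ C i),
    (∀ i, LocallyOfFiniteType (C i).hom) →
    (∀ i, IsNormalization (ν i).left) → IsNormalization (Limits.Pi.map ν : ∏ᶜ N ⟶ ∏ᶜ C).left ∧
      LocallyOfFiniteType (∏ᶜ C).hom) ?_ ?_ ?_ ι ‹_›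
  · intro α β e ih _ C N ν hC hν
    have : Finite α := .of_equiv _ e.symm
    have h := ih ‹_› (fun i ↦ C (e i)) (fun i ↦ N (e i)) (fun i ↦ ν (e i)) (fun i ↦ hC _)
      fun i ↦ hν _
    exact IsNormalization.piMap_of_equiv e C N ν h.1 h.2
  · intro _ C N ν _ _
    exact IsNormalization.piMap_of_isEmpty C N ν
  · intro α _ ih _ C N ν hC hν
    have : Finite α := inferInstance
    have h := ih ‹_› (fun i ↦ C (some i)) (fun i ↦ N (some i)) (fun i ↦ ν (some i)) (fun i ↦ hC _)
      fun i ↦ hν _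
    have := hC none
    exact IsNormalization.piMap_option C N ν (hν none) h.1 h.2

end Product

/-! ### Restriction of a quotient to open subsets -/

section QuotientSections

variable {X Y P Q : Scheme.{u}}

/-- The condition on sections over `U` in the definition of the quotient by `σ`: pull-back along
`π` identifies the sections over `U` with the invariant sections over the preimage of `U`. -/
structure HasInvariantSections (σ : X ⟶ X) (π : X ⟶ Q) (h : σ ≫ π = π) (U : Q.Opens) : Prop where
  injective : Function.Injective (π.app U)
  exists_of_invariant : ∀ s : Γ(X, π ⁻¹ᵁ U),
    σ.appLE (π ⁻¹ᵁ U) (π ⁻¹ᵁ U) (by rw [← Scheme.Hom.comp_preimage, h]) s = s →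
      ∃ t : Γ(Q, U), π.app U t = s

/-- The commutative square formed by `j : Y ⟶ X` and `i : P ⟶ Q` exhibits `p : Y ⟶ P`, with the
endomorphism `σ'` of `Y`, as a restriction of `π : X ⟶ Q`, with the endomorphism `σ` of `X`, to an
open subset of `Q`. -/
structure IsOpenRestriction (σ' : Y ⟶ Y) (p : Y ⟶ P) (σ : X ⟶ X) (π : X ⟶ Q) (j : Y ⟶ X)
    (i : P ⟶ Q) [IsOpenImmersion j] [IsOpenImmersion i] : Prop where
  w : p ≫ i = j ≫ π
  equivariant : σ' ≫ j = j ≫ σ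
  range : π ⁻¹ᵁ i.opensRange = j.opensRange

lemma bijective_appLE_of_isOpenImmersion (j : Y ⟶ X) [IsOpenImmersion j] {W : X.Opens}
    {W' : Y.Opens} (h : W = j ''ᵁ W') (h' : W' ≤ j ⁻¹ᵁ W) :
    Function.Bijective (j.appLE W W' h') := by
  subst h
  rw [← Scheme.Hom.appIso_hom']
  exact (j.appIso W').commRingCatIsoToRingEquiv.bijective

namespace IsOpenRestriction

variable {σ' : Y ⟶ Y} {p : Y ⟶ P} {σ : X ⟶ X} {π : X ⟶ Q} {j : Y ⟶ X} {i : P ⟶ Q}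
  [IsOpenImmersion j] [IsOpenImmersion i] (r : IsOpenRestriction σ' p σ π j i)

include r

lemma apply (y : Y) : i (p y) = π (j y) := by
  rw [← Scheme.Hom.comp_apply, ← Scheme.Hom.comp_apply, r.w]

lemma exists_eq {x : X} {z : P} (h : π x = i z) : ∃ y, j y = x ∧ p y = z := by
  have : x ∈ π ⁻¹ᵁ i.opensRange := ⟨z, h.symm⟩
  rw [r.range] at this
  obtain ⟨y, rfl⟩ := this
  exact ⟨y, rfl, i.isOpenEmbedding.injective (by rw [r.apply, h])⟩

lemma preimage_image (U : P.Opens) : π ⁻¹ᵁ (i ''ᵁ U) = j ''ᵁ (p ⁻¹ᵁ U) := by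
  ext x
  constructor
  · rintro ⟨z, hz, hx⟩
    obtain ⟨y, rfl, rfl⟩ := r.exists_eq hx.symm
    exact ⟨y, hz, rfl⟩
  · rintro ⟨y, hy, rfl⟩
    exact ⟨p y, hy, r.apply y⟩

lemma invariant (h : σ ≫ π = π) : σ' ≫ p = p := by
  rw [← cancel_mono i, Category.assoc, r.w, reassoc_of% r.equivariant, h]

/-- The sections of `P` over `U` are the invariant sections of `Y` precisely if the same holds for
`Q`, `X` and the image of `U`, since `i` and `j` induce isomorphisms on these sections. -/
lemma hasInvariantSections_iff (h : σ ≫ π = π) (U : P.Opens) :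
    HasInvariantSections σ' p (r.invariant h) U ↔ HasInvariantSections σ π h (i ''ᵁ U) := by
  have hW := r.preimage_image U
  have hW' : p ⁻¹ᵁ U ≤ j ⁻¹ᵁ (π ⁻¹ᵁ (i ''ᵁ U)) := by rw [hW, j.preimage_image_eq]
  have hσ : p ⁻¹ᵁ U ≤ σ' ⁻¹ᵁ (p ⁻¹ᵁ U) := by
    rw [← Scheme.Hom.comp_preimage, r.invariant h]
  have hσ' : π ⁻¹ᵁ (i ''ᵁ U) ≤ σ ⁻¹ᵁ (π ⁻¹ᵁ (i ''ᵁ U)) := by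
    rw [← Scheme.Hom.comp_preimage, h]
  have b₁ := bijective_appLE_of_isOpenImmersion i (W' := U) rfl (i.preimage_image_eq U).ge
  have b₂ := bijective_appLE_of_isOpenImmersion j hW hW'
  have e₁ : i.appLE (i ''ᵁ U) U (i.preimage_image_eq U).ge ≫ p.app U =
      π.app (i ''ᵁ U) ≫ j.appLE _ _ hW' := by
    rw [Scheme.Hom.app_eq_appLE, Scheme.Hom.app_eq_appLE, Scheme.Hom.appLE_comp_appLE,
      Scheme.Hom.appLE_comp_appLE]
    simp_rw [r.w]
  have e₂ : j.appLE _ _ hW' ≫ σ'.appLE _ _ hσ = σ.appLE _ _ hσ' ≫ j.appLE _ _ hW' := by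
    rw [Scheme.Hom.appLE_comp_appLE, Scheme.Hom.appLE_comp_appLE]
    simp_rw [r.equivariant]
  have e₁' (t) : p.app U (i.appLE (i ''ᵁ U) U (i.preimage_image_eq U).ge t) =
    j.appLE _ _ hW' (π.app (i ''ᵁ U) t) := congr($e₁ t)
  have e₂' (s) : σ'.appLE _ _ hσ (j.appLE _ _ hW' s) = j.appLE _ _ hW' (σ.appLE _ _ hσ' s) :=
    congr($e₂ s)
  constructor
  · rintro ⟨hi, he⟩
    refine ⟨fun t t' htt' ↦ b₁.1 (hi ?_), fun s hs ↦ ?_⟩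
    · rw [e₁', e₁', htt']
    · obtain ⟨t, ht⟩ := he (j.appLE _ _ hW' s) (by rw [e₂', hs])
      obtain ⟨t, rfl⟩ := b₁.2 t
      exact ⟨t, b₂.1 (by rw [← ht, e₁'])⟩
  · rintro ⟨hi, he⟩
    refine ⟨fun t t' htt' ↦ ?_, fun s hs ↦ ?_⟩
    · obtain ⟨t, rfl⟩ := b₁.2 t
      obtain ⟨t', rfl⟩ := b₁.2 t'
      rw [e₁', e₁'] at htt'
      rw [hi (b₂.1 htt')]
    · obtain ⟨s, rfl⟩ := b₂.2 s
      rw [e₂'] at hs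
      obtain ⟨t, ht⟩ := he s (b₂.1 hs)
      exact ⟨_, by rw [e₁', ht]⟩

lemma isAffineHom [IsAffineHom π] : IsAffineHom p :=
  MorphismProperty.of_isPullback (P := @IsAffineHom)
    (IsOpenImmersion.isPullback p j i π r.w.symm r.range).flip ‹_›

lemma isQuotientMap (h : Topology.IsQuotientMap π) : Topology.IsQuotientMap p := by
  rw [Topology.isQuotientMap_iff]
  refine ⟨.of_isOpen_preimage_iff_isOpen fun s ↦ ⟨fun hs ↦ ?_, fun hs ↦ hs.preimage p.continuous⟩,
    fun z ↦ ?_⟩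
  · have : π ⁻¹' (i '' s) = j '' (p ⁻¹' s) := by
      ext x
      constructor
      · rintro ⟨z, hz, hx⟩
        obtain ⟨y, rfl, rfl⟩ := r.exists_eq hx.symm
        exact ⟨y, hz, rfl⟩
      · rintro ⟨y, hy, rfl⟩
        exact ⟨p y, hy, r.apply y⟩
    have h' : IsOpen (i '' s) := by
      rw [← h.isOpen_preimage, this]
      exact j.isOpenEmbedding.isOpenMap _ hs
    simpa [Set.preimage_image_eq _ i.isOpenEmbedding.injective] using h'.preimage i.continuous
  · obtain ⟨x, hx⟩ := h.surjective (i z)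
    obtain ⟨y, -, hy⟩ := r.exists_eq hx
    exact ⟨y, hy⟩

/-- The restriction of a quotient to an open subset of the target is a quotient. -/
lemma isQuotientByInvolution (h : IsQuotientByInvolution σ π) : IsQuotientByInvolution σ' p := by
  have := h.isAffineHom
  have key (U : P.Opens) : HasInvariantSections σ' p (r.invariant h.invariant) U :=
    (r.hasInvariantSections_iff h.invariant U).mpr ⟨h.injective _, h.exists_of_invariant _⟩
  refine ⟨r.isAffineHom, r.invariant h.invariant, r.isQuotientMap h.isQuotientMap,
    fun y y' hy ↦ ?_, fun U ↦ (key U).1, fun U ↦ (key U).2⟩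
  have e : j (σ' y) = σ (j y) := by
    rw [← Scheme.Hom.comp_apply, ← Scheme.Hom.comp_apply, r.equivariant]
  refine (h.orbit (j y) (j y') (by rw [← r.apply, ← r.apply, hy])).imp
    (fun h ↦ j.isOpenEmbedding.injective h) fun h ↦ j.isOpenEmbedding.injective (by rw [h, e])

end IsOpenRestriction

/-- The condition on sections may be checked on a basis of open sets. -/
lemma HasInvariantSections.of_basis {σ : X ⟶ X} {π : X ⟶ Q} {h : σ ≫ π = π} (p : Q.Opens → Prop)
    (hp : ∀ (x : Q) (U : Q.Opens), x ∈ U → ∃ B, p B ∧ x ∈ B ∧ B ≤ U)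
    (H : ∀ B, p B → HasInvariantSections σ π h B) (U : Q.Opens) :
    HasInvariantSections σ π h U := by
  have nat {U V : Q.Opens} (hUV : V ≤ U) (t) : π.app V (Q.presheaf.map (homOfLE hUV).op t) =
      X.presheaf.map (homOfLE (π.preimage_mono hUV)).op (π.app U t) :=
    congr($(π.naturality (homOfLE hUV).op) t)
  have inj (U : Q.Opens) : Function.Injective (π.app U) := by
    intro t t' htt'
    choose B hB hx hBU using fun x : U ↦ hp x.1 U x.2
    refine TopCat.Sheaf.eq_of_locally_eq' Q.sheaf B U (fun x ↦ homOfLE (hBU x))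
      (fun x hx' ↦ TopologicalSpace.Opens.mem_iSup.mpr ⟨⟨x, hx'⟩, hx _⟩) _ _ fun x ↦ ?_
    refine (H _ (hB x)).injective ?_
    refine (nat (hBU x) t).trans (.trans ?_ (nat (hBU x) t').symm)
    rw [htt']
  refine ⟨inj U, fun s hs ↦ ?_⟩
  -- local descents of `s` are unique by injectivity, hence glue
  choose B hB hx hBU using fun x : U ↦ hp x.1 U x.2
  have res (x : U) : ∃ t : Γ(Q, B x), π.app (B x) t =
      X.presheaf.map (homOfLE (π.preimage_mono (hBU x))).op s := by
    refine (H _ (hB x)).exists_of_invariant _ ?_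
    have hσ (V : Q.Opens) : π ⁻¹ᵁ V ≤ σ ⁻¹ᵁ (π ⁻¹ᵁ V) := by rw [← Scheme.Hom.comp_preimage, h]
    have e : X.presheaf.map (homOfLE (π.preimage_mono (hBU x))).op ≫ σ.appLE _ _ (hσ (B x)) =
        σ.appLE _ _ (hσ U) ≫ X.presheaf.map (homOfLE (π.preimage_mono (hBU x))).op := by
      rw [Scheme.Hom.map_appLE, Scheme.Hom.appLE_map]
    exact congr($e s).trans congr(X.presheaf.map (homOfLE (π.preimage_mono (hBU x))).op $hs)
  choose t ht using res
  obtain ⟨t₀, ht₀, -⟩ := TopCat.Sheaf.existsUnique_gluing' Q.sheaf B U (fun x ↦ homOfLE (hBU x))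
    (fun x hx' ↦ TopologicalSpace.Opens.mem_iSup.mpr ⟨⟨x, hx'⟩, hx _⟩) t fun x y ↦ by
      refine inj _ ?_
      have e₁ : X.presheaf.map (homOfLE (π.preimage_mono (hBU x))).op ≫
            X.presheaf.map (homOfLE (π.preimage_mono (inf_le_left : B x ⊓ B y ≤ B x))).op =
          X.presheaf.map (homOfLE (π.preimage_mono (hBU y))).op ≫
            X.presheaf.map (homOfLE (π.preimage_mono (inf_le_right : B x ⊓ B y ≤ B y))).op := by
        rw [← Functor.map_comp, ← Functor.map_comp]
        rfl
      refine (nat inf_le_left (t x)).trans (.trans ?_ (nat inf_le_right (t y)).symm)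
      rw [ht, ht]
      exact congr($e₁ s)
  refine ⟨t₀, TopCat.Sheaf.eq_of_locally_eq' X.sheaf (fun x ↦ π ⁻¹ᵁ B x) _
    (fun x ↦ homOfLE (π.preimage_mono (hBU x))) (fun x hx' ↦
      TopologicalSpace.Opens.mem_iSup.mpr ⟨⟨π x, hx'⟩, hx ⟨π x, hx'⟩⟩) _ _ fun x ↦ ?_⟩
  refine (nat (hBU x) t₀).symm.trans (.trans ?_ (ht x))
  exact congr(π.app (B x) $(ht₀ x))

end QuotientSections

/-! ### Quotients are local on the target -/

section QuotientLocal

variable {X Q : Scheme.{u}}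

/-- Being a quotient may be checked locally on the target. -/
theorem IsQuotientByInvolution.of_forall_exists {σ : X ⟶ X} {π : X ⟶ Q} (h : σ ≫ π = π)
    (H : ∀ q : Q, ∃ (Y P : Scheme.{u}) (σ' : Y ⟶ Y) (p : Y ⟶ P) (j : Y ⟶ X) (i : P ⟶ Q)
      (_ : IsOpenImmersion j) (_ : IsOpenImmersion i), IsOpenRestriction σ' p σ π j i ∧
        IsQuotientByInvolution σ' p ∧ q ∈ i.opensRange) : IsQuotientByInvolution σ π := by
  have hS (U : Q.Opens) : HasInvariantSections σ π h U := by
    refine .of_basis (fun U ↦ HasInvariantSections σ π h U) (fun q U hq ↦ ?_) (fun _ h ↦ h) U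
    obtain ⟨Y, P, σ', p, j, i, _, _, r, h', ⟨z, rfl⟩⟩ := H q
    refine ⟨i ''ᵁ (i ⁻¹ᵁ U), ?_, ⟨z, hq, rfl⟩, ?_⟩
    · exact (r.hasInvariantSections_iff h _).mp ⟨h'.injective _, h'.exists_of_invariant _⟩
    · rintro _ ⟨z, hz, rfl⟩
      exact hz
  refine ⟨?_, h, ⟨.of_isOpen_preimage_iff_isOpen fun s ↦ ⟨fun hs ↦ ?_,
    fun hs ↦ hs.preimage π.continuous⟩, fun q ↦ ?_⟩, fun x x' hx ↦ ?_,
    fun U ↦ (hS U).1, fun U ↦ (hS U).2⟩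
  · refine isAffineHom_of_forall_exists_isAffineOpen π fun q ↦ ?_
    obtain ⟨Y, P, σ', p, j, i, _, _, r, h', ⟨z, rfl⟩⟩ := H q
    obtain ⟨U, hU, hz, -⟩ := exists_isAffineOpen_mem_and_subset (U := ⊤) (x := z) trivial
    have := h'.isAffineHom
    refine ⟨i ''ᵁ U, ⟨z, hz, rfl⟩, hU.image_of_isOpenImmersion i, ?_⟩
    rw [r.preimage_image]
    exact (hU.preimage p).image_of_isOpenImmersion j
  · rw [isOpen_iff_mem_nhds]
    intro q hq
    obtain ⟨Y, P, σ', p, j, i, _, _, r, h', ⟨z, rfl⟩⟩ := H q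
    have h₁ : IsOpen (i ⁻¹' s) := by
      rw [← h'.isQuotientMap.isOpen_preimage, ← Set.preimage_comp]
      have : i ∘ p = π ∘ j := funext r.apply
      rw [this, Set.preimage_comp]
      exact hs.preimage j.continuous
    exact Filter.mem_of_superset ((i.isOpenEmbedding.isOpenMap _ h₁).mem_nhds ⟨z, hq, rfl⟩)
      (Set.image_preimage_subset _ _)
  · obtain ⟨Y, P, σ', p, j, i, _, _, r, h', ⟨z, rfl⟩⟩ := H q
    obtain ⟨y, rfl⟩ := h'.isQuotientMap.surjective z
    exact ⟨j y, (r.apply y).symm⟩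
  · obtain ⟨Y, P, σ', p, j, i, _, _, r, h', ⟨z, hz⟩⟩ := H (π x)
    obtain ⟨y, rfl, rfl⟩ := r.exists_eq hz.symm
    obtain ⟨y', rfl, hy'⟩ := r.exists_eq (hx.symm.trans hz.symm)
    have e : j (σ' y) = σ (j y) := by
      rw [← Scheme.Hom.comp_apply, ← Scheme.Hom.comp_apply, r.equivariant]
    exact (h'.orbit y y' hy'.symm).imp (congrArg _) fun h ↦ by rw [h, e]

end QuotientLocal

/-! ### Quotients of affine schemes -/

section QuotientAffine

/-- Taking invariants commutes with localization at an invariant element. -/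
lemma exists_of_invariant_of_isLocalizationAway {A B A' B' : Type*} [CommRing A] [CommRing B]
    [CommRing A'] [CommRing B'] [Algebra B B'] [Algebra A A'] (φ : B →+* A) (φ' : B' →+* A')
    (τ : A →+* A) (τ' : A' →+* A') (b : B) [IsLocalization.Away b B']
    [IsLocalization.Away (φ b) A'] (hφ' : ∀ x, φ' (algebraMap B B' x) = algebraMap A A' (φ x))
    (hτ' : ∀ x, τ' (algebraMap A A' x) = algebraMap A A' (τ x)) (hτ : ∀ x, τ (φ x) = φ x)
    (inj : Function.Injective φ) (ex : ∀ a, τ a = a → ∃ x, φ x = a) :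
    Function.Injective φ' ∧ ∀ s, τ' s = s → ∃ t, φ' t = s := by
  have hu : IsUnit (algebraMap B B' b) := IsLocalization.Away.algebraMap_isUnit b
  have hu' : IsUnit (algebraMap A A' (φ b)) := IsLocalization.Away.algebraMap_isUnit (φ b)
  constructor
  · rw [injective_iff_map_eq_zero]
    intro t ht
    obtain ⟨n, x, hx⟩ := IsLocalization.Away.surj b t
    have h₁ : algebraMap A A' (φ x) = 0 := by rw [← hφ', ← hx, map_mul, ht, zero_mul]
    obtain ⟨m, hm⟩ := IsLocalization.Away.exists_of_eq (φ b) (h₁.trans (map_zero _).symm)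
    have h₂ : b ^ m * x = 0 := inj (by simpa using hm)
    have h₃ : algebraMap B B' b ^ m * (algebraMap B B' b ^ n * t) = 0 := by
      rw [mul_comm _ t, hx, ← map_pow, ← map_mul, h₂, map_zero]
    exact (hu.pow n).mul_right_eq_zero.mp ((hu.pow m).mul_right_eq_zero.mp h₃)
  · intro s hs
    obtain ⟨n, a, ha⟩ := IsLocalization.Away.surj (φ b) s
    have h₁ : algebraMap A A' (τ a) = algebraMap A A' a := by
      rw [← hτ', ← ha, map_mul, hs, map_pow, hτ', hτ]
    obtain ⟨m, hm⟩ := IsLocalization.Away.exists_of_eq (φ b) h₁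
    obtain ⟨x, hx⟩ := ex (φ b ^ m * a) (by rw [map_mul, map_pow, hτ, hm])
    obtain ⟨v, hv⟩ := (hu.pow (m + n)).exists_left_inv
    refine ⟨v * algebraMap B B' x, ?_⟩
    have h₂ : φ' v * algebraMap A A' (φ b) ^ (m + n) = 1 := by
      rw [← hφ', ← map_pow, ← map_mul, hv, map_one]
    rw [map_mul, hφ', hx, map_mul, ← ha, map_pow]
    linear_combination s * h₂

variable {X Q : Scheme.{u}}

/-- For affine schemes, the condition on global sections suffices: over a basic open subset of the
quotient, it is the compatibility of invariants with localization at an invariant element. -/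
lemma HasInvariantSections.of_isAffine [IsAffine X] [IsAffine Q] {σ : X ⟶ X} {π : X ⟶ Q}
    {h : σ ≫ π = π} (H : HasInvariantSections σ π h ⊤) (U : Q.Opens) :
    HasInvariantSections σ π h U := by
  refine .of_basis (fun B ↦ ∃ b : Γ(Q, ⊤), B = Q.basicOpen b) (fun x U hx ↦ ?_) ?_ U
  · obtain ⟨_, ⟨_, ⟨b, rfl⟩, rfl⟩, hb, hb'⟩ :=
      (isBasis_basicOpen Q).exists_subset_of_mem_open hx U.isOpen
    exact ⟨_, ⟨b, rfl⟩, hb, hb'⟩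
  · rintro _ ⟨b, rfl⟩
    have hσ (V : Q.Opens) : π ⁻¹ᵁ V ≤ σ ⁻¹ᵁ (π ⁻¹ᵁ V) := by rw [← Scheme.Hom.comp_preimage, h]
    let rQ := Q.presheaf.map (homOfLE (le_top : Q.basicOpen b ≤ ⊤)).op
    let rX := X.presheaf.map (homOfLE (π.preimage_mono (le_top : Q.basicOpen b ≤ ⊤))).op
    let _ : Algebra Γ(Q, ⊤) Γ(Q, Q.basicOpen b) := rQ.hom.toAlgebra
    let _ : Algebra Γ(X, π ⁻¹ᵁ ⊤) Γ(X, π ⁻¹ᵁ Q.basicOpen b) := rX.hom.toAlgebra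
    have l₁ : IsLocalization.Away b Γ(Q, Q.basicOpen b) :=
      (isAffineOpen_top Q).isLocalization_of_eq_basicOpen b _ rfl
    have l₂ : IsLocalization.Away ((π.app ⊤).hom b) Γ(X, π ⁻¹ᵁ Q.basicOpen b) :=
      (isAffineOpen_top X).isLocalization_of_eq_basicOpen _ _ (Scheme.preimage_basicOpen π b)
    have e₁ : rQ ≫ π.app (Q.basicOpen b) = π.app ⊤ ≫ rX := π.naturality _
    have e₂ : rX ≫ σ.appLE _ _ (hσ (Q.basicOpen b)) = σ.appLE _ _ (hσ ⊤) ≫ rX := by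
      rw [Scheme.Hom.map_appLE, Scheme.Hom.appLE_map]
    have e₃ : π.app ⊤ ≫ σ.appLE _ _ (hσ ⊤) = π.app ⊤ := by
      rw [Scheme.Hom.app_eq_appLE, Scheme.Hom.appLE_comp_appLE]
      simp_rw [h]
    obtain ⟨h₁, h₂⟩ := exists_of_invariant_of_isLocalizationAway (π.app ⊤).hom
      (π.app (Q.basicOpen b)).hom (σ.appLE _ _ (hσ ⊤)).hom (σ.appLE _ _ (hσ (Q.basicOpen b))).hom b
      (fun x ↦ congr($e₁ x)) (fun x ↦ congr($e₂ x)) (fun x ↦ congr($e₃ x)) H.1 H.2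
    exact ⟨h₁, h₂⟩

/-- Two primes with the same contraction to the ring of invariants of an involution are
conjugate. -/
lemma eq_or_eq_comap_of_comap_eq {A B : Type*} [CommRing A] [CommRing B] (φ : B →+* A)
    (τ : A →+* A) (hτ : ∀ a, τ (τ a) = a) (ex : ∀ a, τ a = a → ∃ x, φ x = a)
    {p q : PrimeSpectrum A} (h : PrimeSpectrum.comap φ p = PrimeSpectrum.comap φ q) :
    q = p ∨ q = PrimeSpectrum.comap τ p := by
  have key {p q : PrimeSpectrum A} (h : PrimeSpectrum.comap φ p = PrimeSpectrum.comap φ q) :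
      q.asIdeal ≤ p.asIdeal ∨ q.asIdeal ≤ p.asIdeal.comap τ := by
    -- the invariant `a * τ a` lies in `q`, hence in `p`
    refine Ideal.subset_union.mp fun a ha ↦ ?_
    obtain ⟨x, hx⟩ := ex (a * τ a) (by rw [map_mul, hτ, mul_comm])
    have h₁ : x ∈ (PrimeSpectrum.comap φ q).asIdeal := by
      change φ x ∈ q.asIdeal
      rw [hx]
      exact q.asIdeal.mul_mem_right _ ha
    rw [← h] at h₁
    change φ x ∈ p.asIdeal at h₁
    rw [hx] at h₁
    exact p.isPrime.mem_or_mem h₁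
  -- inclusions of conjugate primes are equalities, as the involution can be applied to them
  have conj {p q : Ideal A} (h : p ≤ q.comap τ) : p.comap τ ≤ q := fun a ha ↦ by
    have := h (show τ a ∈ p from ha)
    rwa [Ideal.mem_comap, hτ] at this
  have conj' {p q : Ideal A} (h : p ≤ q) : p.comap τ ≤ q.comap τ := Ideal.comap_mono h
  rcases key h with h₁ | h₁ <;> rcases key h.symm with h₂ | h₂
  · exact .inl (PrimeSpectrum.ext (le_antisymm h₁ h₂))
  · exact .inl (PrimeSpectrum.ext (le_antisymm h₁ (h₂.trans ((conj' h₁).trans (conj h₂)))))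
  · exact .inl (PrimeSpectrum.ext (le_antisymm (h₁.trans ((conj' h₂).trans (conj h₁))) h₂))
  · exact .inr (PrimeSpectrum.ext (le_antisymm h₁ (conj h₂)))

/-- The spectrum of the ring of invariants is the quotient; it carries the quotient topology since
integral ring extensions induce closed surjective maps on spectra. -/
lemma isQuotientByInvolution_specMap {A B : CommRingCat.{u}} (φ : B ⟶ A) (τ : A ⟶ A)
    (hτ : τ ≫ τ = 𝟙 A) (hφ : φ ≫ τ = φ) (inj : Function.Injective φ)
    (ex : ∀ a, τ a = a → ∃ x, φ x = a) :
    IsQuotientByInvolution (Spec.map τ) (Spec.map φ) := by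
  have h : Spec.map τ ≫ Spec.map φ = Spec.map φ := by rw [← Spec.map_comp, hφ]
  have hτ' (a) : τ (τ a) = a := congr($hτ a)
  have hint : φ.hom.IsIntegral := isIntegral_of_invariant φ.hom τ.hom hτ' ex
  have hS : HasInvariantSections (Spec.map τ) (Spec.map φ) h ⊤ := by
    have b₁ := (Scheme.ΓSpecIso B).commRingCatIsoToRingEquiv.bijective
    have b₂ := (Scheme.ΓSpecIso A).commRingCatIsoToRingEquiv.bijective
    have e₁ (x) : (Scheme.ΓSpecIso A).hom ((Spec.map φ).app ⊤ x) = φ ((Scheme.ΓSpecIso B).hom x) :=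
      congr($(Scheme.ΓSpecIso_naturality φ) x)
    have e₂ (x) : (Scheme.ΓSpecIso A).hom ((Spec.map τ).app ⊤ x) = τ ((Scheme.ΓSpecIso A).hom x) :=
      congr($(Scheme.ΓSpecIso_naturality τ) x)
    refine ⟨fun x y hxy ↦ b₁.1 (inj ?_), fun s hs ↦ ?_⟩
    · exact (e₁ x).symm.trans (congr((Scheme.ΓSpecIso A).hom $hxy).trans (e₁ y))
    · have hs' : (Spec.map τ).app ⊤ s = s := by rwa [Scheme.Hom.app_eq_appLE]
      obtain ⟨x, hx⟩ := ex ((Scheme.ΓSpecIso A).hom s)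
        ((e₂ s).symm.trans congr((Scheme.ΓSpecIso A).hom $hs'))
      obtain ⟨x, rfl⟩ := b₁.2 x
      exact ⟨x, b₂.1 ((e₁ x).trans hx)⟩
  refine ⟨inferInstance, h, ?_, fun x y hxy ↦ ?_,
    fun U ↦ (hS.of_isAffine U).1, fun U ↦ (hS.of_isAffine U).2⟩
  · exact (PrimeSpectrum.isClosedMap_comap_of_isIntegral φ.hom hint).isQuotientMap
      (Spec.map φ).continuous (hint.comap_surjective inj)
  · exact eq_or_eq_comap_of_comap_eq φ.hom τ.hom hτ' ex hxy

/-- An affine scheme has a quotient by an involution, the spectrum of the ring of invariants. -/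
theorem exists_isQuotientByInvolution_of_isAffine [IsAffine X] (σ : X ⟶ X) (hσ : σ ≫ σ = 𝟙 X) :
    ∃ (Q : Scheme.{u}) (_ : IsAffine Q) (π : X ⟶ Q), IsQuotientByInvolution σ π := by
  let τ : Γ(X, ⊤) ⟶ Γ(X, ⊤) := σ.appTop
  let φ : CommRingCat.of (RingHom.eqLocus τ.hom (RingHom.id _)) ⟶ Γ(X, ⊤) :=
    CommRingCat.ofHom (Subring.subtype _)
  have hτ : τ ≫ τ = 𝟙 _ := by rw [← Scheme.Hom.comp_appTop, hσ, Scheme.Hom.id_appTop]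
  have h := isQuotientByInvolution_specMap φ τ hτ (by ext x; exact x.2) Subtype.val_injective
    fun a ha ↦ ⟨⟨a, ha⟩, rfl⟩
  refine ⟨_, inferInstance, X.isoSpec.hom ≫ Spec.map φ,
    IsOpenRestriction.isQuotientByInvolution (j := X.isoSpec.hom) (i := 𝟙 _) ⟨?_, ?_, ?_⟩ h⟩
  · rw [Category.comp_id]
  · exact (Scheme.isoSpec_hom_naturality σ).symm
  · rw [Scheme.Hom.opensRange_of_isIso, Scheme.Hom.opensRange_of_isIso, Scheme.Hom.preimage_top]

end QuotientAffine

/-! ### The universal property of quotients -/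

section QuotientUniversal

/-- A ring homomorphism with values in the range of an injective one factors through it. -/
lemma exists_comp_eq_of_injective {A B C : Type*} [CommRing A] [CommRing B] [CommRing C]
    (i : B →+* A) (hi : Function.Injective i) (j : C →+* A) (h : ∀ c, ∃ b, i b = j c) :
    ∃ l : C →+* B, i.comp l = j := by
  let e : B ≃+* i.range := .ofBijective i.rangeRestrict
    ⟨fun x y hxy ↦ hi congr(($hxy).1), i.rangeRestrict_surjective⟩
  refine ⟨e.symm.toRingHom.comp (j.codRestrict i.range fun c ↦ h c), ?_⟩
  ext c
  exact congr(($(e.apply_symm_apply (j.codRestrict i.range (fun c ↦ h c) c))).1)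

variable {X Q Z : Scheme.{u}} {σ : X ⟶ X} {π : X ⟶ Q}

/-- A quotient morphism is surjective, and injective on sections. -/
lemma IsQuotientByInvolution.epi (h : IsQuotientByInvolution σ π) : Epi π := by
  refine ⟨fun {Z} f g hfg ↦ ?_⟩
  have hb (q : Q) : f q = g q := by
    obtain ⟨x, rfl⟩ := h.isQuotientMap.surjective q
    rw [← Scheme.Hom.comp_apply, ← Scheme.Hom.comp_apply, hfg]
  have hb' : f.base = g.base := by
    ext q
    exact hb q
  refine Scheme.Hom.ext hb' fun U ↦ ?_
  have hU : g ⁻¹ᵁ U ≤ f ⁻¹ᵁ U := fun q hq ↦ by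
    change f q ∈ U
    rw [hb]
    exact hq
  change f.app U ≫ Q.presheaf.map _ = g.app U
  ext s
  refine h.injective _ ?_
  have e : f.appLE U (g ⁻¹ᵁ U) hU ≫ π.app (g ⁻¹ᵁ U) = g.app U ≫ π.app (g ⁻¹ᵁ U) := by
    rw [Scheme.Hom.app_eq_appLE, Scheme.Hom.app_eq_appLE, Scheme.Hom.appLE_comp_appLE,
      Scheme.Hom.appLE_comp_appLE]
    simp_rw [hfg]
  exact congr($e s)

/-- The quotient by an involution has the universal property of the quotient for morphisms of
schemes. -/
theorem IsQuotientByInvolution.exists_desc (h : IsQuotientByInvolution σ π) (f : X ⟶ Z)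
    (hf : σ ≫ f = f) : ∃ g : Q ⟶ Z, π ≫ g = f := by
  have hfac : Function.FactorsThrough f.base.hom π.base.hom := fun x y hxy ↦ by
    rcases h.orbit x y hxy with rfl | rfl
    · rfl
    · change f x = f (σ x)
      rw [← Scheme.Hom.comp_apply, hf]
  let g₀ : C(Q, Z) := Topology.IsQuotientMap.lift (f := π.base.hom) h.isQuotientMap f.base.hom hfac
  have hg₀' : g₀.comp π.base.hom = f.base.hom :=
    Topology.IsQuotientMap.lift_comp (f := π.base.hom) ..
  let g : TopCat.of Q ⟶ TopCat.of Z := TopCat.ofHom g₀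
  have hg : π.base ≫ g = f.base := TopCat.hom_ext hg₀'
  let W (V : Z.Opens) : Q.Opens := (TopologicalSpace.Opens.map g).obj V
  have hW (V : Z.Opens) : π ⁻¹ᵁ W V = f ⁻¹ᵁ V := by
    change (TopologicalSpace.Opens.map (π.base ≫ g)).obj V = _
    rw [hg]
  have hσ (U : Q.Opens) : π ⁻¹ᵁ U ≤ σ ⁻¹ᵁ (π ⁻¹ᵁ U) := by
    rw [← Scheme.Hom.comp_preimage, h.invariant]
  -- the pull-back of a section of `Z` to `X` is invariant, hence descends uniquely to `Q`
  have hc (V : Z.Opens) : ∃ l : Γ(Z, V) ⟶ Γ(Q, W V), l ≫ π.app (W V) = f.appLE V _ (hW V).le := by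
    obtain ⟨l, hl⟩ := exists_comp_eq_of_injective (π.app (W V)).hom (h.injective _)
      (f.appLE V _ (hW V).le).hom fun s ↦ h.exists_of_invariant _ _ <| by
        have e : f.appLE V _ (hW V).le ≫ σ.appLE _ _ (hσ _) = f.appLE V _ (hW V).le := by
          rw [Scheme.Hom.appLE_comp_appLE]
          simp_rw [hf]
        exact congr($e s)
    exact ⟨CommRingCat.ofHom l, CommRingCat.hom_ext hl⟩
  choose c hc using hc
  let G : Q.toPresheafedSpace.Hom Z.toPresheafedSpace :=
    { base := g
      c :=
        { app := fun V ↦ c V.unop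
          naturality := fun V V' i ↦ by
            have : Mono (π.app (W V'.unop)) :=
              ConcreteCategory.mono_of_injective _ (h.injective _)
            rw [← cancel_mono (π.app (W V'.unop))]
            rw [Category.assoc, hc, Scheme.Hom.map_appLE]
            have e := π.naturality ((TopologicalSpace.Opens.map g).map i.unop).op
            refine .trans ?_ (congr(c V.unop ≫ $e).symm.trans (Category.assoc _ _ _).symm)
            refine .trans ?_ (Category.assoc _ _ _)
            refine .trans ?_ congr($(hc V.unop) ≫ _).symm
            exact (Scheme.Hom.appLE_map ..).symm } }
  have hG : PresheafedSpace.comp π.toPshHom G = f.toPshHom := by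
    refine PresheafedSpace.Hom.ext _ _ hg ?_
    refine NatTrans.ext (funext fun V ↦ ?_)
    have e : (c V.unop ≫ π.app (W V.unop)) ≫ X.presheaf.map (eqToHom (hW V.unop).symm).op =
        f.app V.unop := by
      rw [hc, Scheme.Hom.appLE_map, Scheme.Hom.app_eq_appLE]
    refine .trans ?_ e
    exact congrArg (fun i ↦ (c V.unop ≫ π.app (W V.unop)) ≫ X.presheaf.map i)
      (Subsingleton.elim _ _)
  -- locality of the maps on stalks of `G` follows from that of `f`, as `π` is surjective
  have hloc (F : X.toPresheafedSpace.Hom Z.toPresheafedSpace) (hF : F = f.toPshHom) (x : X) :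
      IsLocalHom (F.stalkMap x).hom := by
    subst hF
    exact f.prop x
  have hG' (q : Q) : IsLocalHom (G.stalkMap q).hom := by
    obtain ⟨x, rfl⟩ := h.isQuotientMap.surjective q
    have h₁ := hloc _ hG x
    have h₂ := PresheafedSpace.stalkMap.comp π.toPshHom G x
    have h₃ : IsLocalHom (((π.toPshHom).stalkMap x).hom.comp (G.stalkMap (π x)).hom) :=
      CommRingCat.hom_comp _ _ ▸ h₂ ▸ h₁
    exact isLocalHom_of_comp _ ((π.toPshHom).stalkMap x).hom
  let g' : Q ⟶ Z := ⟨⟨G, hG'⟩⟩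
  exact ⟨g', Scheme.Hom.ext' (LocallyRingedSpace.Hom.ext' hG)⟩

/-- Two quotients of a scheme by the same involution are isomorphic. -/
lemma IsQuotientByInvolution.exists_iso {Q' : Scheme.{u}} {π' : X ⟶ Q'}
    (h : IsQuotientByInvolution σ π) (h' : IsQuotientByInvolution σ π') :
    ∃ e : Q ≅ Q', π ≫ e.hom = π' := by
  obtain ⟨f, hf⟩ := h.exists_desc π' h'.invariant
  obtain ⟨g, hg⟩ := h'.exists_desc π h.invariant
  have := h.epi
  have := h'.epi
  refine ⟨⟨f, g, ?_, ?_⟩, hf⟩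
  · rw [← cancel_epi π, reassoc_of% hf, hg, Category.comp_id]
  · rw [← cancel_epi π', reassoc_of% hg, hf, Category.comp_id]

/-- An open subset stable under the involution is the preimage of an open subset of the
quotient. -/
lemma IsQuotientByInvolution.exists_preimage_eq (h : IsQuotientByInvolution σ π) {W : X.Opens}
    (hW : W ≤ σ ⁻¹ᵁ W) : ∃ O : Q.Opens, π ⁻¹ᵁ O = W := by
  have : π ⁻¹' (π '' W) = W := by
    refine subset_antisymm (fun x ⟨w, hw, hx⟩ ↦ ?_) (Set.subset_preimage_image _ _)
    rcases h.orbit w x hx with rfl | rfl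
    · exact hw
    · exact hW hw
  refine ⟨⟨π '' W, ?_⟩, TopologicalSpace.Opens.ext this⟩
  rw [← h.isQuotientMap.isOpen_preimage, this]
  exact W.isOpen

variable {Y : Scheme.{u}} {σ' : Y ⟶ Y}

/-- An equivariant open immersion into a scheme with a quotient is the restriction of the quotient
to an open subset. -/
lemma IsQuotientByInvolution.exists_isOpenRestriction (h : IsQuotientByInvolution σ π) (j : Y ⟶ X)
    [IsOpenImmersion j] (hj : σ' ≫ j = j ≫ σ) :
    ∃ (O : Q.Opens) (p : Y ⟶ O), IsOpenRestriction σ' p σ π j O.ι := by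
  obtain ⟨O, hO⟩ := h.exists_preimage_eq (W := j.opensRange) (by
    rintro _ ⟨y, rfl⟩
    refine ⟨σ' y, ?_⟩
    rw [← Scheme.Hom.comp_apply, ← Scheme.Hom.comp_apply, hj])
  refine ⟨O, IsOpenImmersion.lift O.ι (j ≫ π) ?_, IsOpenImmersion.lift_fac .., hj, ?_⟩
  · rintro _ ⟨y, rfl⟩
    rw [Scheme.Opens.range_ι, Scheme.Hom.comp_apply]
    have : j y ∈ π ⁻¹ᵁ O := by
      rw [hO]
      exact ⟨y, rfl⟩
    exact this
  · rw [Scheme.Opens.opensRange_ι, hO]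

/-- The morphism of quotients induced by an equivariant open immersion is an open immersion. -/
lemma IsQuotientByInvolution.exists_isOpenRestriction_of_isQuotient {P : Scheme.{u}} {p : Y ⟶ P}
    (h : IsQuotientByInvolution σ π) (h' : IsQuotientByInvolution σ' p) (j : Y ⟶ X)
    [IsOpenImmersion j] (hj : σ' ≫ j = j ≫ σ) :
    ∃ (i : P ⟶ Q) (_ : IsOpenImmersion i), IsOpenRestriction σ' p σ π j i := by
  obtain ⟨O, p', r⟩ := h.exists_isOpenRestriction j hj
  obtain ⟨e, he⟩ := h'.exists_iso (r.isQuotientByInvolution h)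
  refine ⟨e.hom ≫ O.ι, inferInstance, ?_, hj, ?_⟩
  · rw [reassoc_of% he, r.w]
  · rw [← r.range, Scheme.Hom.opensRange_comp_of_isIso]

end QuotientUniversal

/-! ### Gluing of quotients -/

section QuotientGluing

/-- Morphisms on the members of an open cover glue if they agree on the intersections. -/
lemma exists_glue {X Z : Scheme.{u}} {ι : Type*} (U : ι → X.Opens) (hU : ∀ x, ∃ i, x ∈ U i)
    (f : ∀ i, (U i).toScheme ⟶ Z) (hf : ∀ i j, X.homOfLE (inf_le_left : U i ⊓ U j ≤ U i) ≫ f i =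
      X.homOfLE (inf_le_right : U i ⊓ U j ≤ U j) ≫ f j) : ∃ g : X ⟶ Z, ∀ i, (U i).ι ≫ g = f i := by
  let 𝒰 : X.OpenCover := X.openCoverOfIsOpenCover U
    (top_le_iff.mp fun x _ ↦ TopologicalSpace.Opens.mem_iSup.mpr (hU x))
  refine ⟨𝒰.glueMorphisms f fun i j ↦ ?_, 𝒰.ι_glueMorphisms f _⟩
  change pullback.fst (U i).ι (U j).ι ≫ f i = pullback.snd (U i).ι (U j).ι ≫ f j
  let l : pullback (U i).ι (U j).ι ⟶ (U i ⊓ U j).toScheme :=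
    IsOpenImmersion.lift (U i ⊓ U j).ι (pullback.fst (U i).ι (U j).ι ≫ (U i).ι) <| by
      rw [Scheme.Opens.range_ι]
      rintro _ ⟨x, rfl⟩
      refine ⟨(pullback.fst (U i).ι (U j).ι x).2, ?_⟩
      rw [pullback.condition]
      exact (pullback.snd (U i).ι (U j).ι x).2
  have hl : l ≫ (U i ⊓ U j).ι = pullback.fst (U i).ι (U j).ι ≫ (U i).ι :=
    IsOpenImmersion.lift_fac ..
  have h₁ : pullback.fst (U i).ι (U j).ι = l ≫ X.homOfLE inf_le_left := by
    rw [← cancel_mono (U i).ι, Category.assoc, Scheme.homOfLE_ι, hl]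
  have h₂ : pullback.snd (U i).ι (U j).ι = l ≫ X.homOfLE inf_le_right := by
    rw [← cancel_mono (U j).ι, Category.assoc, Scheme.homOfLE_ι, hl, pullback.condition]
  rw [h₁, h₂, Category.assoc, Category.assoc]
  exact congr(l ≫ $(hf i j))

lemma hom_apply_congr {X Y : Scheme.{u}} {f g : X ⟶ Y} (h : f = g) (x : X) : f x = g x := h ▸ rfl

variable {X : Scheme.{u}} (σ : X ⟶ X)

/-- The open subsets which are stable under `σ` and have a quotient by `σ`. -/
structure QuotientOpens : Type u where
  /-- The underlying open subset. -/
  opens : X.Opens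
  stable : opens ≤ σ ⁻¹ᵁ opens
  exists_isQuotient : ∃ (Q : Scheme.{u}) (p : opens.toScheme ⟶ Q),
    IsQuotientByInvolution (σ.resLE opens opens stable) p

namespace QuotientOpens

variable {σ}

instance : Preorder (QuotientOpens σ) := Preorder.lift opens

lemma le_of_hom {U V : QuotientOpens σ} (f : U ⟶ V) : U.opens ≤ V.opens := f.le

/-- The restriction of `σ` to a stable open subset. -/
noncomputable def res (U : QuotientOpens σ) : U.opens.toScheme ⟶ U.opens.toScheme :=
  σ.resLE U.opens U.opens U.stable

/-- A chosen quotient of `U` by `σ`. -/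
noncomputable def quotient (U : QuotientOpens σ) : Scheme.{u} := U.exists_isQuotient.choose

/-- The quotient morphism to the chosen quotient. -/
noncomputable def proj (U : QuotientOpens σ) : U.opens.toScheme ⟶ U.quotient :=
  U.exists_isQuotient.choose_spec.choose

lemma isQuotient (U : QuotientOpens σ) : IsQuotientByInvolution U.res U.proj :=
  U.exists_isQuotient.choose_spec.choose_spec

instance (U : QuotientOpens σ) : Epi U.proj := U.isQuotient.epi

lemma resLE_comp_homOfLE {V W : X.Opens} (h : W ≤ V) (hV : V ≤ σ ⁻¹ᵁ V) (hW : W ≤ σ ⁻¹ᵁ W) :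
    σ.resLE W W hW ≫ X.homOfLE h = X.homOfLE h ≫ σ.resLE V V hV := by
  rw [Scheme.Hom.resLE_map, Scheme.Hom.map_resLE]

lemma exists_map {U V : QuotientOpens σ} (h : U.opens ≤ V.opens) :
    ∃ i : U.quotient ⟶ V.quotient, IsOpenImmersion i ∧ U.proj ≫ i = X.homOfLE h ≫ V.proj := by
  obtain ⟨i, hi, r⟩ := V.isQuotient.exists_isOpenRestriction_of_isQuotient U.isQuotient
    (X.homOfLE h) (resLE_comp_homOfLE h _ _)
  exact ⟨i, hi, r.w⟩

/-- The open immersion between chosen quotients induced by an inclusion. -/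
noncomputable def map {U V : QuotientOpens σ} (h : U.opens ≤ V.opens) : U.quotient ⟶ V.quotient :=
  (exists_map h).choose

instance {U V : QuotientOpens σ} (h : U.opens ≤ V.opens) : IsOpenImmersion (map h) :=
  (exists_map h).choose_spec.1

lemma proj_map {U V : QuotientOpens σ} (h : U.opens ≤ V.opens) :
    U.proj ≫ map h = X.homOfLE h ≫ V.proj :=
  (exists_map h).choose_spec.2

/-- The intersection of two stable open subsets with a quotient. -/
def inf (U V : QuotientOpens σ) : QuotientOpens σ where
  opens := U.opens ⊓ V.opens
  stable := inf_le_inf U.stable V.stable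
  exists_isQuotient := by
    obtain ⟨O, p, r⟩ := U.isQuotient.exists_isOpenRestriction
      (X.homOfLE (inf_le_left : U.opens ⊓ V.opens ≤ U.opens))
      (resLE_comp_homOfLE _ U.stable (inf_le_inf U.stable V.stable))
    exact ⟨_, p, r.isQuotientByInvolution U.isQuotient⟩

variable (σ)

/-- The diagram of the chosen quotients. -/
noncomputable def diagram : QuotientOpens σ ⥤ Scheme.{u} where
  obj U := U.quotient
  map h := map (le_of_hom h)
  map_id U := by
    rw [← cancel_epi U.proj, proj_map, Scheme.homOfLE_rfl, Category.id_comp, Category.comp_id]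
  map_comp {U V W} h h' := by
    rw [← cancel_epi U.proj, proj_map, reassoc_of% proj_map (le_of_hom h), proj_map,
      Scheme.homOfLE_homOfLE_assoc]

instance {U V : QuotientOpens σ} (f : U ⟶ V) : IsOpenImmersion ((diagram σ).map f) :=
  inferInstanceAs (IsOpenImmersion (map (le_of_hom f)))

lemma map_proj_apply {U V : QuotientOpens σ} (h : U.opens ≤ V.opens) (x : U.opens.toScheme) :
    map h (U.proj x) = V.proj (X.homOfLE h x) :=
  hom_apply_congr (proj_map h) x

/-- If points of two stable open subsets have the same image in the quotient of a larger one, then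
the second lies in both, with the same images in the quotients. -/
lemma exists_proj_eq {U U' V : QuotientOpens σ} (h : U.opens ≤ V.opens) (h' : U'.opens ≤ V.opens)
    (x : U.opens.toScheme) (x' : U'.opens.toScheme)
    (e : map h (U.proj x) = map h' (U'.proj x')) :
    ∃ y : U.opens.toScheme, y.1 = x'.1 ∧ U.proj y = U.proj x := by
  rw [map_proj_apply, map_proj_apply] at e
  have coe {W : QuotientOpens σ} (hW : W.opens ≤ V.opens) (w : W.opens.toScheme) :
      (X.homOfLE hW w).1 = w.1 := Scheme.homOfLE_apply ..
  rcases V.isQuotient.orbit _ _ e with h₁ | h₁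
  · exact ⟨x, (coe h x).symm.trans (congr(($h₁).1).symm.trans (coe h' x')), rfl⟩
  · have h₂ : V.res (X.homOfLE h x) = X.homOfLE h (U.res x) :=
      (hom_apply_congr (resLE_comp_homOfLE h V.stable U.stable) x).symm
    rw [h₂] at h₁
    exact ⟨U.res x, (coe h _).symm.trans (congr(($h₁).1).symm.trans (coe h' x')),
      hom_apply_congr U.isQuotient.invariant x⟩

/-- Points of two quotients with a common image in a third come from the quotient of the
intersection; this makes the colimit of the diagram of open immersions a gluing. -/
instance : (diagram σ ⋙ Scheme.forget).IsLocallyDirected where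
  cond {U U' V} f f' z z' e := by
    obtain ⟨x, rfl⟩ := U.isQuotient.isQuotientMap.surjective z
    obtain ⟨x', rfl⟩ := U'.isQuotient.isQuotientMap.surjective z'
    obtain ⟨y, hy, hy'⟩ := exists_proj_eq σ (le_of_hom f) (le_of_hom f') x x' e
    let w : (inf U U').opens.toScheme := ⟨y.1, y.2, by rw [hy]; exact x'.2⟩
    have h₁ : (inf U U').opens ≤ U.opens := inf_le_left
    have h₂ : (inf U U').opens ≤ U'.opens := inf_le_right
    have e₁ : X.homOfLE h₁ w = y := Subtype.ext (Scheme.homOfLE_apply ..)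
    have e₂ : X.homOfLE h₂ w = x' := Subtype.ext ((Scheme.homOfLE_apply ..).trans hy)
    refine ⟨inf U U', homOfLE h₁, homOfLE h₂, (inf U U').proj w, ?_, ?_⟩
    · exact (map_proj_apply σ h₁ w).trans (congr(U.proj $e₁).trans hy')
    · exact (map_proj_apply σ h₂ w).trans congr(U'.proj $e₂)

/-- The gluing of the chosen quotients. -/
noncomputable def glued : Scheme.{u} := colimit (diagram σ)

variable {σ} in
/-- The open immersion of a chosen quotient into the gluing. -/
noncomputable def toGlued (U : QuotientOpens σ) : U.quotient ⟶ glued σ := colimit.ι (diagram σ) U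

variable {σ} in
instance (U : QuotientOpens σ) : IsOpenImmersion U.toGlued :=
  inferInstanceAs (IsOpenImmersion (colimit.ι (diagram σ) U))

variable {σ} in
lemma map_toGlued {U V : QuotientOpens σ} (h : U.opens ≤ V.opens) : map h ≫ V.toGlued = U.toGlued :=
  colimit.w (diagram σ) (homOfLE h : U ⟶ V)

lemma exists_toGlued_eq (q : glued σ) : ∃ (U : QuotientOpens σ) (z : U.quotient), U.toGlued z = q :=
  Scheme.IsLocallyDirected.ι_jointly_surjective (diagram σ) q

lemma exists_of_toGlued_eq {U V : QuotientOpens σ} {z : U.quotient} {z' : V.quotient}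
    (h : U.toGlued z = V.toGlued z') : ∃ (W : QuotientOpens σ) (f : W.opens ≤ U.opens)
      (g : W.opens ≤ V.opens) (w : W.quotient), map f w = z ∧ map g w = z' := by
  obtain ⟨W, f, g, w, h₁, h₂⟩ := (Scheme.IsLocallyDirected.ι_eq_ι_iff (diagram σ)).mp h
  exact ⟨W, le_of_hom f, le_of_hom g, w, h₁, h₂⟩

end QuotientOpens

open QuotientOpens in
/-- A quotient exists as soon as it exists locally. -/
theorem exists_isQuotientByInvolution (H : ∀ x : X, ∃ U : QuotientOpens σ, x ∈ U.opens) :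
    ∃ (Q : Scheme.{u}) (π : X ⟶ Q), IsQuotientByInvolution σ π := by
  obtain ⟨π, hπ⟩ := exists_glue (fun U : QuotientOpens σ ↦ U.opens) H
    (fun U ↦ U.proj ≫ U.toGlued) fun U V ↦ by
      have h₁ : (QuotientOpens.inf U V).opens ≤ U.opens := inf_le_left
      have h₂ : (QuotientOpens.inf U V).opens ≤ V.opens := inf_le_right
      have e₁ := congr($(proj_map h₁) ≫ U.toGlued)
      have e₂ := congr($(proj_map h₂) ≫ V.toGlued)
      rw [Category.assoc, map_toGlued] at e₁ e₂
      exact (Category.assoc _ _ _).symm.trans (e₁.symm.trans (e₂.trans (Category.assoc _ _ _)))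
  have hπ' (U : QuotientOpens σ) (x : U.opens.toScheme) : U.toGlued (U.proj x) = π x.1 :=
    (hom_apply_congr (hπ U) x).symm
  have hσ : σ ≫ π = π := by
    refine Scheme.hom_ext_of_forall _ _ fun x ↦ ?_
    obtain ⟨U, hx⟩ := H x
    refine ⟨U.opens, hx, ?_⟩
    have : U.opens.ι ≫ σ = U.res ≫ U.opens.ι := (Scheme.Hom.resLE_comp_ι ..).symm
    rw [reassoc_of% this, hπ, reassoc_of% U.isQuotient.invariant]
  refine ⟨glued σ, π, .of_forall_exists hσ fun q ↦ ?_⟩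
  obtain ⟨U, z, rfl⟩ := exists_toGlued_eq σ q
  refine ⟨_, _, U.res, U.proj, U.opens.ι, U.toGlued, inferInstance, inferInstance,
    ⟨(hπ U).symm, Scheme.Hom.resLE_comp_ι .., ?_⟩, U.isQuotient, ⟨z, rfl⟩⟩
  -- a point of `X` whose image lies in the quotient of `U` is, up to `σ`, a point of `U`
  ext x
  rw [Scheme.Opens.opensRange_ι]
  refine ⟨fun ⟨z, hz⟩ ↦ ?_, fun hx ↦ ⟨U.proj ⟨x, hx⟩, hπ' U ⟨x, hx⟩⟩⟩
  obtain ⟨V, hx⟩ := H x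
  obtain ⟨W, f, g, w, rfl, hw⟩ := exists_of_toGlued_eq σ (hz.trans (hπ' V ⟨x, hx⟩).symm)
  obtain ⟨w, rfl⟩ := W.isQuotient.isQuotientMap.surjective w
  obtain ⟨y, hy, -⟩ := exists_proj_eq σ g le_rfl w ⟨x, hx⟩
    (hw.trans ((map_proj_apply σ le_rfl ⟨x, hx⟩).trans
      congr(V.proj $(Scheme.homOfLE_apply' ..))).symm)
  have : x = y.1 := hy.symm
  rw [this]
  exact f y.2

end QuotientGluing

/-! ### Affine opens of projective schemes -/

section Projective

attribute [local instance] MvPolynomial.gradedAlgebra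

variable {k : Type u} [Field k] {n : ℕ}

/-- Some homogeneous coordinate does not vanish at a given point of projective space, since the
coordinates generate the irrelevant ideal. -/
lemma exists_X_notMem (x : Proj (MvPolynomial.homogeneousSubmodule (Fin (n + 1)) k)) :
    ∃ i, (MvPolynomial.X i : MvPolynomial (Fin (n + 1)) k) ∉ x.asHomogeneousIdeal := by
  by_contra! h
  refine x.not_irrelevant_le (HomogeneousIdeal.irrelevant_le _ |>.mpr fun d hd f hf ↦ ?_)
  have hf' : f.IsHomogeneous d := hf
  have hle : Ideal.span (MvPolynomial.X '' (Set.univ : Set (Fin (n + 1)))) ≤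
      x.asHomogeneousIdeal.toIdeal := by
    rw [Ideal.span_le]
    rintro _ ⟨i, -, rfl⟩
    exact h i
  refine hle (MvPolynomial.mem_ideal_span_X_image.mpr fun m hm ↦ ?_)
  by_contra! h0
  obtain rfl : m = 0 := Finsupp.ext fun i ↦ h0 i trivial
  have := hf' (MvPolynomial.mem_support_iff.mp hm)
  simp at this
  omega

/-- Two points of a projective space lie in the complement of a common hyperplane: if `X i` does not
vanish at `x` but at `y`, and `X j` does not vanish at `y` but at `x`, then `X i + X j` vanishes at
neither. -/
lemma exists_isAffineOpen_projectiveSpace (x y : (projectiveSpace k n).left) :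
    ∃ U : (projectiveSpace k n).left.Opens, IsAffineOpen U ∧ x ∈ U ∧ y ∈ U := by
  let 𝒜 := MvPolynomial.homogeneousSubmodule (Fin (n + 1)) k
  change Proj 𝒜 at x y
  suffices ∃ f ∈ 𝒜 1, f ∉ x.asHomogeneousIdeal ∧ f ∉ y.asHomogeneousIdeal by
    obtain ⟨f, hf, hx, hy⟩ := this
    exact ⟨Proj.basicOpen 𝒜 f, Proj.isAffineOpen_basicOpen 𝒜 f hf one_pos, hx, hy⟩
  have hX (i) : (MvPolynomial.X i : MvPolynomial (Fin (n + 1)) k) ∈ 𝒜 1 :=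
    MvPolynomial.isHomogeneous_X k i
  obtain ⟨i, hi⟩ := exists_X_notMem x
  obtain ⟨j, hj⟩ := exists_X_notMem y
  by_cases hi' : (MvPolynomial.X i : MvPolynomial (Fin (n + 1)) k) ∈ y.asHomogeneousIdeal
  · by_cases hj' : (MvPolynomial.X j : MvPolynomial (Fin (n + 1)) k) ∈ x.asHomogeneousIdeal
    · refine ⟨_, add_mem (hX i) (hX j), fun h ↦ hi ?_, fun h ↦ hj ?_⟩
      · exact (Ideal.add_mem_iff_left x.asHomogeneousIdeal.toIdeal hj').mp h
      · exact (Ideal.add_mem_iff_right y.asHomogeneousIdeal.toIdeal hi').mp h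
    · exact ⟨_, hX j, hj', hj⟩
  · exact ⟨_, hX i, hi, hi'⟩

/-- The preimage in `C` of a common affine neighbourhood in projective space is affine, as closed
immersions are affine. -/
lemma IsProjective.exists_isAffineOpen {C : Over (Spec (.of k))} (hC : IsProjective C)
    (x y : C.left) : ∃ U : C.left.Opens, IsAffineOpen U ∧ x ∈ U ∧ y ∈ U := by
  obtain ⟨n, i, hi⟩ := hC
  obtain ⟨U, hU, hx, hy⟩ := exists_isAffineOpen_projectiveSpace (i.left x) (i.left y)
  exact ⟨i.left ⁻¹ᵁ U, hU.preimage i.left, hx, hy⟩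

end Projective

/-! ### Existence of quotients and symmetric squares -/

section QuotientExistence

lemma resLE_comp_resLE_self {X : Scheme.{u}} {σ : X ⟶ X} (hσ : σ ≫ σ = 𝟙 X) {W : X.Opens}
    (h : W ≤ σ ⁻¹ᵁ W) : σ.resLE W W h ≫ σ.resLE W W h = 𝟙 _ := by
  rw [← cancel_mono W.ι, Category.assoc, Scheme.Hom.resLE_comp_ι,
    reassoc_of% Scheme.Hom.resLE_comp_ι, hσ, Category.comp_id, Category.id_comp]

/-- If every point lies in a stable affine open subset, then the quotient by an involution
exists. -/
theorem exists_isQuotientByInvolution_of_isAffineOpen {X : Scheme.{u}} (σ : X ⟶ X)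
    (hσ : σ ≫ σ = 𝟙 X) (H : ∀ x : X, ∃ W : X.Opens, IsAffineOpen W ∧ x ∈ W ∧ W ≤ σ ⁻¹ᵁ W) :
    ∃ (Q : Scheme.{u}) (π : X ⟶ Q), IsQuotientByInvolution σ π := by
  refine exists_isQuotientByInvolution σ fun x ↦ ?_
  obtain ⟨W, hW, hx, hWσ⟩ := H x
  have : IsAffine W := hW
  obtain ⟨Q, -, p, hp⟩ := exists_isQuotientByInvolution_of_isAffine (σ.resLE W W hWσ)
    (resLE_comp_resLE_self hσ hWσ)
  exact ⟨⟨W, hWσ, Q, p, hp⟩, hx⟩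

variable {k : Type u} [Field k] {C : Over (Spec (.of k))}

lemma braiding_left_comp_self (C : Over (Spec (.of k))) :
    (β_ C C).hom.left ≫ (β_ C C).hom.left = 𝟙 _ := by
  rw [← Over.comp_left, SymmetricCategory.symmetry, Over.id_left]

/-- A quotient of `C × C` by the exchange of factors is a `k`-scheme by the universal property. -/
lemma exists_isSymmetricSquare {Q : Scheme.{u}} {π : (C ⊗ C).left ⟶ Q}
    (h : IsQuotientByInvolution (β_ C C).hom.left π) :
    ∃ (S : Over (Spec (.of k))) (π : C ⊗ C ⟶ S), IsSymmetricSquare π := by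
  obtain ⟨g, hg⟩ := h.exists_desc (C ⊗ C).hom (Over.w (β_ C C).hom)
  exact ⟨Over.mk g, Over.homMk π hg, h⟩

/-- If any two points of `C` lie in a common affine open subset `U`, then `C × C` is covered by the
stable affine open subsets `U × U`, and `C` has a symmetric square. -/
theorem exists_isSymmetricSquare_of_forall_exists_isAffineOpen
    (H : ∀ x y : C.left, ∃ U : C.left.Opens, IsAffineOpen U ∧ x ∈ U ∧ y ∈ U) :
    ∃ (S : Over (Spec (.of k))) (π : C ⊗ C ⟶ S), IsSymmetricSquare π := by
  obtain ⟨Q, π, h⟩ := exists_isQuotientByInvolution_of_isAffineOpen (β_ C C).hom.left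
    (braiding_left_comp_self C) fun z ↦ by
      obtain ⟨U, hU, hx, hy⟩ := H ((SemiCartesianMonoidalCategory.fst C C).left z)
        ((SemiCartesianMonoidalCategory.snd C C).left z)
      refine ⟨prodOpen U U, isAffineOpen_prodOpen hU hU, ⟨hx, hy⟩, ?_⟩
      have h₁ : (β_ C C).hom.left ≫ (SemiCartesianMonoidalCategory.fst C C).left =
          (SemiCartesianMonoidalCategory.snd C C).left := by
        rw [← Over.comp_left, CartesianMonoidalCategory.braiding_hom_fst]
      have h₂ : (β_ C C).hom.left ≫ (SemiCartesianMonoidalCategory.snd C C).left =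
          (SemiCartesianMonoidalCategory.fst C C).left := by
        rw [← Over.comp_left, CartesianMonoidalCategory.braiding_hom_snd]
      rw [prodOpen, Scheme.Hom.preimage_inf, ← Scheme.Hom.comp_preimage, ← Scheme.Hom.comp_preimage,
        h₁, h₂, inf_comm]
  exact exists_isSymmetricSquare h

end QuotientExistence

/-! ### Normalization of quotients -/

section QuotientNormalization

lemma preimage_le_of_comp_eq {X Q : Scheme.{u}} {σ : X ⟶ X} {π : X ⟶ Q} (h : σ ≫ π = π)
    (V : Q.Opens) : π ⁻¹ᵁ V ≤ σ ⁻¹ᵁ (π ⁻¹ᵁ V) := fun x hx ↦ by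
  change π (σ x) ∈ V
  rwa [← Scheme.Hom.comp_apply, h]

variable {X Y Q P : Scheme.{u}} {σ : X ⟶ X} {π : X ⟶ Q} {σ' : Y ⟶ Y} {p : Y ⟶ P}

/-- The given quotient is isomorphic to the spectrum of the ring of invariants. -/
lemma IsQuotientByInvolution.isAffine [IsAffine X] (h : IsQuotientByInvolution σ π)
    (hσ : σ ≫ σ = 𝟙 X) : IsAffine Q := by
  obtain ⟨Q', _, π', h'⟩ := exists_isQuotientByInvolution_of_isAffine σ hσ
  obtain ⟨e, -⟩ := h.exists_iso h'
  exact .of_isIso e.hom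

lemma IsQuotientByInvolution.isAffineOpen (h : IsQuotientByInvolution σ π) (hσ : σ ≫ σ = 𝟙 X)
    {V : Q.Opens} (hV : IsAffineOpen (π ⁻¹ᵁ V)) : IsAffineOpen V := by
  have hV' : π ⁻¹ᵁ V ≤ σ ⁻¹ᵁ (π ⁻¹ᵁ V) := preimage_le_of_comp_eq h.invariant V
  have r : IsOpenRestriction (σ.resLE _ _ hV') (π ∣_ V) σ π (π ⁻¹ᵁ V).ι V.ι :=
    ⟨morphismRestrict_ι .., Scheme.Hom.resLE_comp_ι .., by
      rw [Scheme.Opens.opensRange_ι, Scheme.Opens.opensRange_ι]⟩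
  have : IsAffine (π ⁻¹ᵁ V) := hV
  exact (r.isQuotientByInvolution h).isAffine (resLE_comp_resLE_self hσ _)

/-- The sections of the quotient are subrings of the sections of `X`, hence domains. -/
lemma IsQuotientByInvolution.isIntegral [IsIntegral X] (h : IsQuotientByInvolution σ π) :
    IsIntegral Q where
  nonempty := ⟨π (genericPoint X)⟩
  component_integral V hV := by
    have : Nonempty (π ⁻¹ᵁ V) := by
      obtain ⟨q, hq⟩ := hV
      obtain ⟨x, rfl⟩ := h.isQuotientMap.surjective q
      exact ⟨x, hq⟩
    exact (h.injective V).isDomain (π.app V).hom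

/-- The quotient of a normalization by a lift of the involution is the normalization of the
quotient. -/
theorem IsNormalization.of_isQuotient {ν : Y ⟶ X} {φ : P ⟶ Q} (hν : IsNormalization ν)
    (h : IsQuotientByInvolution σ π) (h' : IsQuotientByInvolution σ' p) (hσ : σ ≫ σ = 𝟙 X)
    (hσ' : σ' ≫ σ' = 𝟙 Y) (hν' : σ' ≫ ν = ν ≫ σ) (hφ : p ≫ φ = ν ≫ π) : IsNormalization φ := by
  have := hν.isIntegral
  have := hν.isIntegralHom
  have := h.isIntegral
  have := h.isAffineHom
  refine .of_forall_exists fun q ↦ ?_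
  obtain ⟨V, hV, hq, -⟩ := exists_isAffineOpen_mem_and_subset (U := ⊤) (x := q) trivial
  have hW : IsAffineOpen (π ⁻¹ᵁ V) := hV.preimage π
  have hW' : p ⁻¹ᵁ (φ ⁻¹ᵁ V) = ν ⁻¹ᵁ (π ⁻¹ᵁ V) := by
    rw [← Scheme.Hom.comp_preimage, ← Scheme.Hom.comp_preimage, hφ]
  have : Nonempty (π ⁻¹ᵁ V) := by
    obtain ⟨x, rfl⟩ := h.isQuotientMap.surjective q
    exact ⟨x, hq⟩
  refine ⟨V, hq, hV, h'.isAffineOpen hσ' (hW' ▸ hW.preimage ν), ?_⟩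
  have hring := (isRingNormalization_app_iff hW').mp (hν.isRingNormalization_app hW)
  have s : π ⁻¹ᵁ V ≤ σ ⁻¹ᵁ (π ⁻¹ᵁ V) := preimage_le_of_comp_eq h.invariant V
  have s' : p ⁻¹ᵁ (φ ⁻¹ᵁ V) ≤ σ' ⁻¹ᵁ (p ⁻¹ᵁ (φ ⁻¹ᵁ V)) := preimage_le_of_comp_eq h'.invariant _
  have e₁ : σ.appLE _ _ s ≫ σ.appLE _ _ s = 𝟙 _ := by
    rw [Scheme.Hom.appLE_comp_appLE]
    simp_rw [hσ]
    rw [Scheme.Hom.appLE, Scheme.Hom.id_app]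
    exact (Category.id_comp _).trans (X.presheaf.map_id _)
  have e₂ : σ.appLE _ _ s ≫ ν.appLE _ _ hW'.le = ν.appLE _ _ hW'.le ≫ σ'.appLE _ _ s' := by
    rw [Scheme.Hom.appLE_comp_appLE, Scheme.Hom.appLE_comp_appLE]
    simp_rw [hν']
  have e₃ : φ.app V ≫ p.app (φ ⁻¹ᵁ V) = π.app V ≫ ν.appLE _ _ hW'.le := by
    rw [Scheme.Hom.app_eq_appLE, Scheme.Hom.app_eq_appLE, Scheme.Hom.app_eq_appLE,
      Scheme.Hom.appLE_comp_appLE, Scheme.Hom.appLE_comp_appLE]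
    simp_rw [hφ]
  have e₄ : π.app V ≫ σ.appLE _ _ s = π.app V := by
    rw [Scheme.Hom.app_eq_appLE, Scheme.Hom.appLE_comp_appLE]
    simp_rw [h.invariant]
  have e₅ : p.app (φ ⁻¹ᵁ V) ≫ σ'.appLE _ _ s' = p.app (φ ⁻¹ᵁ V) := by
    rw [Scheme.Hom.app_eq_appLE, Scheme.Hom.appLE_comp_appLE]
    simp_rw [h'.invariant]
  refine hring.invariants (τ := (σ.appLE _ _ s).hom) (τ' := (σ'.appLE _ _ s').hom)
    (i := (π.app V).hom) (i' := (p.app (φ ⁻¹ᵁ V)).hom)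
    (fun b ↦ congr($e₁ b)) (fun b ↦ congr($e₂ b)) (fun a ↦ congr($e₃ a)) (h.injective _)
    (h'.injective _) (fun a ↦ congr($e₄ a)) (h.exists_of_invariant V) (fun a ↦ congr($e₅ a))
    (h'.exists_of_invariant _)

end QuotientNormalization

/-! ### Symmetric squares and normalization -/

section SymmetricSquare

variable {k : Type u} [Field k] {C N S T : Over (Spec (.of k))}

lemma braiding_left_comp_tensorHom_left (ν : N ⟶ C) :
    (β_ N N).hom.left ≫ (ν ⊗ₘ ν).left = (ν ⊗ₘ ν).left ≫ (β_ C C).hom.left := by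
  rw [← Over.comp_left, ← Over.comp_left, BraidedCategory.braiding_naturality]

/-- If `C` has a symmetric square `S` and `N × N` is affine over `C × C`, then `N` has a symmetric
square: the preimages in `N × N` of the affine opens of `S` are affine, stable, and cover. -/
theorem IsSymmetricSquare.exists_of_isAffineHom {π : C ⊗ C ⟶ S} (h : IsSymmetricSquare π)
    (ν : N ⟶ C) [IsAffineHom (ν ⊗ₘ ν).left] :
    ∃ (T : Over (Spec (.of k))) (ρ : N ⊗ N ⟶ T), IsSymmetricSquare ρ := by
  obtain ⟨Q, ρ, h'⟩ := exists_isQuotientByInvolution_of_isAffineOpen (β_ N N).hom.left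
    (braiding_left_comp_self N) fun z ↦ by
      obtain ⟨V, hV, hz, -⟩ := exists_isAffineOpen_mem_and_subset (U := ⊤)
        (x := π.left ((ν ⊗ₘ ν).left z)) trivial
      have := h.isAffineHom
      refine ⟨((ν ⊗ₘ ν).left ≫ π.left) ⁻¹ᵁ V, (hV.preimage _).preimage _, hz,
        preimage_le_of_comp_eq ?_ V⟩
      rw [reassoc_of% braiding_left_comp_tensorHom_left ν, h.invariant]
  exact exists_isSymmetricSquare h'

/-- The symmetric square of the normalization is the normalization of the symmetric square. -/
theorem IsSymmetricSquare.exists_isNormalization [IsAlgClosed k] {π : C ⊗ C ⟶ S}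
    (h : IsSymmetricSquare π) {ρ : N ⊗ N ⟶ T} (h' : IsSymmetricSquare ρ) {ν : N ⟶ C}
    [LocallyOfFiniteType C.hom] (hν : IsNormalization ν.left) :
    ∃ φ : T ⟶ S, ρ ≫ φ = (ν ⊗ₘ ν) ≫ π ∧ IsNormalization φ.left := by
  obtain ⟨f, hf⟩ := h'.exists_desc ((ν ⊗ₘ ν).left ≫ π.left) (by
    rw [reassoc_of% braiding_left_comp_tensorHom_left ν, h.invariant])
  have hf' : f ≫ S.hom = T.hom := by
    have := h'.epi
    rw [← cancel_epi ρ.left, reassoc_of% hf, Over.w, Over.w, Over.w]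
  exact ⟨Over.homMk f hf', Over.OverMorphism.ext hf, (hν.tensorHom hν).of_isQuotient h h'
    (braiding_left_comp_self C) (braiding_left_comp_self N)
    (braiding_left_comp_tensorHom_left ν) hf⟩

end SymmetricSquare

end NodalCurves

open NodalCurves in
theorem mainTheorem8 (k : Type u) [Field k] [IsAlgClosed k] :
    -- finite products of irreducible nodal curves
    (∀ (ι : Type) [Finite ι] (C N : ι → Over (Spec (.of k))) (ν : ∀ i, N i ⟶ C i),
      (∀ i, IsIrreducibleNodalCurve (C i)) → (∀ i, IsNormalization (ν i).left) →
        IsNormalization (Limits.Pi.map ν : ∏ᶜ N ⟶ ∏ᶜ C).left) ∧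
    -- symmetric squares of irreducible nodal curves
    (∀ (C N : Over (Spec (.of k))) (ν : N ⟶ C),
      IsIrreducibleNodalCurve C → IsNormalization ν.left →
        (IsProjective C → ∃ (S : Over (Spec (.of k))) (π : C ⊗ C ⟶ S), IsSymmetricSquare π) ∧
        (∀ (S : Over (Spec (.of k))) (π : C ⊗ C ⟶ S), IsSymmetricSquare π →
          (∃ (T : Over (Spec (.of k))) (ρ : N ⊗ N ⟶ T), IsSymmetricSquare ρ) ∧
          (∀ (T : Over (Spec (.of k))) (ρ : N ⊗ N ⟶ T), IsSymmetricSquare ρ →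
            ∃ φ : T ⟶ S, ρ ≫ φ = (ν ⊗ₘ ν) ≫ π ∧ IsNormalization φ.left))) := by
  refine ⟨fun ι _ C N ν hC hν ↦
    (IsNormalization.piMap ι C N ν (fun i ↦ (hC i).locallyOfFiniteType) hν).1,
    fun C N ν hC hν ↦ ⟨fun h ↦
      exists_isSymmetricSquare_of_forall_exists_isAffineOpen h.exists_isAffineOpen,
      fun S π hπ ↦ ?_⟩⟩
  have := hC.locallyOfFiniteType
  have : IsAffineHom (ν ⊗ₘ ν).left :=
    have := (hν.tensorHom hν).isIntegralHom
    inferInstance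
  exact ⟨hπ.exists_of_isAffineHom ν, fun T ρ hρ ↦ hπ.exists_isNormalization hρ hν⟩
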